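/- Setting. Let $u(t)\in\mathbb R^p$ $(t\in\mathbb Z)$ be an input signal, $M\ge 0$, $d\ge 1$, $N\ge 0$, $q=pM+1$, $Q=q^d$, $x_t=[1,u(t)^\top,\dots,u(t-M+1)^\top]^\top\in\mathbb R^q$, and let $U\in\mathbb R^{N\times Q}$ have the rows $(x_t^{\otimes d})^\top$, $t=1,\dots,N$. Let $S\subseteq\{1,\dots,p\}$, let $P$ be the diagonal $Q\times Q$ projection onto the monomials that involve only the constant and inputs indexed by $S$, and put $U_S=UP$. Let $Y=UB^\star+E$ with $B^\star\in\mathbb R^{Q\times l}$ and $E\in\mathbb R^{N\times l}$. View $\mathbb R^{Q\times l}$, with the Frobenius inner product, as the space of tensors $\mathcal B(j,i_1,\dots,i_d)$. Fix $r_0=l$, $r_1,\dots,r_{d-1}$, $r_d=1$. Let $\mathcal T_{\le\mathbf r}(S)$ (resp. $\mathcal T_{\mathbf r}(S)$) be the set of $B$ with $PB=B$ such that for $1\le k\le d-1$ the unfolding of $B$ with rows $(j,i_1,\dots,i_k)$ and columns $(i_{k+1},\dots,i_d)$ has rank $\le r_k$ (resp. $=r_k$). Let $\tau$ map a tuple of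 cores $\mathcal U=(V^{(1)},\dots,V^{(d)})$, $V^{(k)}\in\mathbb R^{r_{k-1}\times q_S\times r_k}$ with $q_S=|S|M+1$ (mode indices: the constant and the delayed inputs from $S$), to the tensor with entries $\sum_{\alpha_1,\dots,\alpha_{d-1}}V^{(1)}(j,i_1,\alpha_1)V^{(2)}(\alpha_1,i_2,\alpha_2)\cdots V^{(d)}(\alpha_{d-1},i_d,1)$, extended by zero to the monomials with inputs outside $S$. Let $L(B)=\|Y-U_SB\|_F^2$ and $j(\mathcal U)=L(\tau(\mathcal U))$. Let $B^{(0)}$ be a minimizer of $\|B-PB^\star\|_F^2$ over $\mathcal T_{\le\mathbf r}(S)$, let $\tau(\mathcal U^{(0)})=B^{(0)}$, and assume the regularity condition that $B^{(0)}$ has TT rank exactly $\mathbf r$, i.e. $B^{(0)}\in\mathcal T_{\mathbf r}(S)$. Let $T$ be the tangent space of $\mathcal T_{\mathbf r}(S)$ at $B^{(0)}$ (the velocities at $B^{(0)}$ of smooth curves in it). Put $R_{\rm omitted}=U(I-P)B^\star$, $R_{\rm proj}=U_S(PB^\star-B^{(0)})$, $C=U_S^\top R_{\rm omitted}$, $J=\tau'(\mathcal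 U^{(0)})$, and $g(R)=-2J^*[U_S^\top R]$, $g_{\rm omitted}=g(R_{\rm omitted})$, $g_{\rm proj}=g(R_{\rm proj})$, $g_{\rm noise}=g(E)$. Theorem. 1. $\tau$ is smooth and $\operatorname{Im}J=T$; the gradient $\nabla j(\mathcal U^{(0)})$ exists and equals $g_{\rm omitted}+g_{\rm proj}+g_{\rm noise}$. 2. $g_{\rm omitted}\ne0$ if and only if $C$ is not orthogonal to $T$; likewise, the block of $g_{\rm omitted}$ belonging to at least one core is nonzero if and only if $C$ is not orthogonal to $T$. 3. If $C$ is not orthogonal to $T$, then $\xi=J(-g_{\rm omitted})\in T$ and $\langle C,\xi\rangle>0$. 4. If $C$ is not orthogonal to $T$ and $g_{\rm omitted}$ is not cancelled, i.e. $g_{\rm proj}+g_{\rm noise}\ne-g_{\rm omitted}$, then $g=\nabla j(\mathcal U^{(0)})\ne0$, and for all sufficiently small $t>0$ one has $j(\mathcal U^{(0)}-tg)<j(\mathcal U^{(0)})$ and $B^{(0)}\neq\tau(\mathcal U^{(0)}-tg)\in\mathcal T_{\mathbf r}(S)$. Moreover, the block of $g$ belonging to some core is nonzero, and for every $i$ such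 that the block of $g$ belonging to the $i$-th core is nonzero: (a) least-squares updates of the $i$-th core (minimizers of $j$ in this core, the others being fixed) exist, and each of them strictly decreases $j$ and yields a tensor in $\mathcal T_{\le\mathbf r}(S)$ different from $B^{(0)}$; (b) for each pair of adjacent cores $(k,k+1)$ that contains the $i$-th core, least-squares updates $W$ of the merged super-core exist, and each has a decrease of the loss $\Delta J_{\rm LS}>0$. If $\mathcal U^{(1)}$ is obtained by an SVD truncation of $W$, reshaped to a matrix, to a rank $\le r_k$, and a splitting into two cores, then $j(\mathcal U^{(0)})-j(\mathcal U^{(1)})=\Delta J_{\rm LS}-\Delta_{\rm trunc}$, where the truncation loss $\Delta_{\rm trunc}$ is the squared Frobenius norm of the difference of the predictions before and after truncation. If $\Delta_{\rm trunc}<\Delta J_{\rm LS}$, then $j(\mathcal U^{(1)})<j(\mathcal U^{(0)})$ and $B^{(0)}\ne\tau(\mathcal U^{(1)})\in\mathcal T_{\le\mathbf r}(S)$. -/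

import Mathlib

open scoped Topology ContDiff Matrix

noncomputable section

namespace THA

/-! ### Volterra features, masks, coefficient tensors -/

/-- Index set of the augmented input vector `[1, u(t), u(t-1), …, u(t-M+1)]`:
`none` is the constant `1`, and `some (a, m)` is the delayed input `u_a(t-m)`.
It has `q = p * M + 1` elements. -/
abbrev Feature (p M : ℕ) : Type := Option (Fin p × Fin M)

/-- The augmented input vector at time `t`. -/
def augInput {p : ℕ} (M : ℕ) (u : ℤ → Fin p → ℝ) (t : ℤ) : Feature p M → ℝ
  | none => 1
  | some (a, m) => u (t - (m : ℕ)) a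

/-- The design matrix: its rows, at the times `1, …, N`, are the `d`-fold Kronecker
powers of the augmented input vectors. -/
def designMatrix {p : ℕ} (M d N : ℕ) (u : ℤ → Fin p → ℝ) :
    Matrix (Fin N) (Fin d → Feature p M) ℝ :=
  Matrix.of fun t i => ∏ m : Fin d, augInput M u ((t : ℕ) + 1) (i m)

/-- The feature is the constant or a delayed copy of an input indexed by `S`. -/
def Included {p M : ℕ} (S : Finset (Fin p)) (f : Feature p M) : Prop :=
  ∀ x ∈ f, x.1 ∈ S

instance {p M : ℕ} (S : Finset (Fin p)) : DecidablePred (Included (M := M) S) := fun f =>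
  inferInstanceAs (Decidable (∀ x ∈ f, x.1 ∈ S))

/-- The features that are available to the head with input set `S`. -/
abbrev HeadFeature {p : ℕ} (M : ℕ) (S : Finset (Fin p)) : Type :=
  {f : Feature p M // Included S f}

/-- The mask operator: the diagonal projection onto the monomials that only involve inputs
indexed by `S`. -/
def mask {p : ℕ} (M d : ℕ) (S : Finset (Fin p)) :
    Matrix (Fin d → Feature p M) (Fin d → Feature p M) ℝ :=
  Matrix.diagonal fun i => if ∀ m, Included S (i m) then 1 else 0

/-- Coefficient tensors with `l` outputs and `d` modes indexed by `ι`, with the Frobenius inner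
product. -/
abbrev Coeff (ι : Type) (d l : ℕ) : Type := EuclideanSpace ℝ ((Fin d → ι) × Fin l)

/-- The `Q × l` matricization of a coefficient tensor. -/
def mat {ι : Type} {d l : ℕ} (B : Coeff ι d l) : Matrix (Fin d → ι) (Fin l) ℝ :=
  Matrix.of fun i j => B (i, j)

/-- The coefficient tensor with a given `Q × l` matricization. -/
def unmat {ι : Type} {d l : ℕ} (A : Matrix (Fin d → ι) (Fin l) ℝ) : Coeff ι d l :=
  WithLp.toLp 2 fun x => A x.1 x.2

/-- The squared Frobenius norm of a matrix. -/
def frobSq {m n : Type} [Fintype m] [Fintype n] (A : Matrix m n ℝ) : ℝ :=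
  ∑ i, ∑ j, A i j ^ 2

/-! ### Tensor trains -/

/-- The tuples of TT cores `V⁽ᵏ⁾ ∈ ℝ^(r_{k-1} × ι × r_k)`, with the Frobenius inner product.
The ranks are `r 0 = l` (the number of outputs), the inner ranks, and `r (Fin.last d) = 1`. -/
abbrev Cores {d : ℕ} (r : Fin (d + 1) → ℕ) (ι : Type) : Type :=
  PiLp 2 fun k : Fin d => EuclideanSpace ℝ (Fin (r k.castSucc) × ι × Fin (r k.succ))

/-- The contraction of a tuple of cores. The bond indices `α 0 = j, α 1, …, α d` are summed over,
and the last of them takes a single value when `r (Fin.last d) = 1`. -/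
def contract {d : ℕ} {r : Fin (d + 1) → ℕ} {ι : Type} [Fintype ι] (V : Cores r ι) :
    Coeff ι d (r 0) :=
  WithLp.toLp 2 fun x => ∑ α : (b : Fin (d + 1)) → Fin (r b),
    if α 0 = x.2 then ∏ k : Fin d, V k (α k.castSucc, x.1 k, α k.succ) else 0

/-- Embedding of the coefficient tensors of a head into the full coefficient space, by zero on
the monomials that involve an input outside `S`. -/
def zeroExtend {p M d l : ℕ} (S : Finset (Fin p)) (B : Coeff (HeadFeature M S) d l) :
    Coeff (Feature p M) d l :=
  WithLp.toLp 2 fun x =>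
    if h : ∀ m, Included S (x.1 m) then B (fun m => ⟨x.1 m, h m⟩, x.2) else 0

/-- The core-to-tensor map `τ` of the head with input set `S`. -/
def tau {p M d : ℕ} {r : Fin (d + 1) → ℕ} (S : Finset (Fin p))
    (V : Cores r (HeadFeature M S)) : Coeff (Feature p M) d (r 0) :=
  zeroExtend S (contract V)

/-- The unfolding of a tensor at bond `b`: the rows are indexed by the output and the first `b`
modes, the columns by the remaining modes. -/
def unfold {ι : Type} {d l : ℕ} (B : Coeff ι d l) (b : ℕ) :
    Matrix (Fin l × ({m : Fin d // m.val < b} → ι)) ({m : Fin d // ¬ m.val < b} → ι) ℝ :=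
  Matrix.of fun x i' => B (fun m => if h : m.val < b then x.2 ⟨m, h⟩ else i' ⟨m, h⟩, x.1)

/-- The feasible set of a head: the tensors supported on the monomials in the inputs from `S`,
with TT ranks (ranks of the unfoldings at the inner bonds) at most `r`. -/
def ttBounded {p M d : ℕ} (r : Fin (d + 1) → ℕ) (S : Finset (Fin p)) :
    Set (Coeff (Feature p M) d (r 0)) :=
  {B | mask M d S * mat B = mat B ∧
    ∀ b : Fin (d + 1), b ≠ 0 → b ≠ Fin.last d → (unfold B b).rank ≤ r b}

/-- The TT manifold of a head: the tensors supported on the monomials in the inputs from `S`,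
with TT ranks exactly `r`. -/
def ttManifold {p M d : ℕ} (r : Fin (d + 1) → ℕ) (S : Finset (Fin p)) :
    Set (Coeff (Feature p M) d (r 0)) :=
  {B | mask M d S * mat B = mat B ∧
    ∀ b : Fin (d + 1), b ≠ 0 → b ≠ Fin.last d → (unfold B b).rank = r b}

/-- The tangent space of a submanifold `X` of a normed space at `x`: the velocities at `x` of
the smooth curves in `X` through `x`. -/
def tangentSpaceAt {F : Type} [NormedAddCommGroup F] [NormedSpace ℝ F] (X : Set F) (x : F) :
    Set F :=
  {v | ∃ γ : ℝ → F, ContDiff ℝ ∞ γ ∧ γ 0 = x ∧ (∀ᶠ t in 𝓝 (0 : ℝ), γ t ∈ X) ∧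
    HasDerivAt γ v 0}

/-- `c` is orthogonal to every element of `X`. -/
def OrthogonalTo {F : Type} [NormedAddCommGroup F] [InnerProductSpace ℝ F] (c : F) (X : Set F) :
    Prop :=
  ∀ v ∈ X, inner ℝ c v = 0

/-! ### Loss, baseline, residual components -/

/-- The included features `U_k = U P_k`. -/
def designIn {p : ℕ} (M d N : ℕ) (u : ℤ → Fin p → ℝ) (S : Finset (Fin p)) :
    Matrix (Fin N) (Fin d → Feature p M) ℝ :=
  designMatrix M d N u * mask M d S

/-- The omitted features `U_{¬k} = U (I - P_k)`. -/
def designOut {p : ℕ} (M d N : ℕ) (u : ℤ → Fin p → ℝ) (S : Finset (Fin p)) :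
    Matrix (Fin N) (Fin d → Feature p M) ℝ :=
  designMatrix M d N u * (1 - mask M d S)

/-- The empirical loss `L(B) = ‖Y - U_k B‖_F²` of a head. -/
def loss {p M d N l : ℕ} (u : ℤ → Fin p → ℝ) (S : Finset (Fin p)) (Y : Matrix (Fin N) (Fin l) ℝ)
    (B : Coeff (Feature p M) d l) : ℝ :=
  frobSq (Y - designIn M d N u S * mat B)

/-- `B₀` is a feasible TT projection: a best approximation of the truncated parameters
`P_k B⋆` in the feasible set of the head. -/
def IsFeasibleProjection {p M d : ℕ} (r : Fin (d + 1) → ℕ) (S : Finset (Fin p))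
    (Bstar B₀ : Coeff (Feature p M) d (r 0)) : Prop :=
  B₀ ∈ ttBounded r S ∧ ∀ B ∈ ttBounded r S,
    frobSq (mat B₀ - mask M d S * mat Bstar) ≤ frobSq (mat B - mask M d S * mat Bstar)

/-- The omitted dynamics `R_omitted = U_{¬k} B⋆_{¬k}`, where `B⋆_{¬k} = (I - P_k) B⋆`. -/
def resOmitted {p M d l : ℕ} (N : ℕ) (u : ℤ → Fin p → ℝ) (S : Finset (Fin p))
    (Bstar : Coeff (Feature p M) d l) : Matrix (Fin N) (Fin l) ℝ :=
  designOut M d N u S * ((1 - mask M d S) * mat Bstar)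

/-- The projection error `R_proj_err = U_k (P_k B⋆ - B₀)`. -/
def resProj {p M d l : ℕ} (N : ℕ) (u : ℤ → Fin p → ℝ) (S : Finset (Fin p))
    (Bstar B₀ : Coeff (Feature p M) d l) : Matrix (Fin N) (Fin l) ℝ :=
  designIn M d N u S * (mask M d S * mat Bstar - mat B₀)

/-- The global correlation `C = U_kᵀ R_omitted`. -/
def globalCorrelation {p M d l : ℕ} (N : ℕ) (u : ℤ → Fin p → ℝ) (S : Finset (Fin p))
    (Bstar : Coeff (Feature p M) d l) : Coeff (Feature p M) d l :=
  unmat ((designIn M d N u S)ᵀ * resOmitted N u S Bstar)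

/-- The part `-2 J_τ(V)* [U_kᵀ R]` of the gradient of the parametrized loss at `V` that is
induced by a component `R` of the residual. -/
def gradPart {p M d N : ℕ} {r : Fin (d + 1) → ℕ} (u : ℤ → Fin p → ℝ) (S : Finset (Fin p))
    (V : Cores r (HeadFeature M S)) (R : Matrix (Fin N) (Fin (r 0)) ℝ) :
    Cores r (HeadFeature M S) :=
  (-2 : ℝ) • ContinuousLinearMap.adjoint (fderiv ℝ (tau S) V)
    (unmat ((designIn M d N u S)ᵀ * R))

/-! ### Block updates -/

/-- Replace the `k`-th core by `z`. -/
def replaceCore {d : ℕ} {r : Fin (d + 1) → ℕ} {ι : Type} (V : Cores r ι) (k : Fin d)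
    (z : EuclideanSpace ℝ (Fin (r k.castSucc) × ι × Fin (r k.succ))) : Cores r ι :=
  WithLp.toLp 2 (Function.update V.ofLp k z)

/-- The core after the `k`-th one. -/
def next {d : ℕ} (k : Fin d) (h : k.val + 1 < d) : Fin d := ⟨k.val + 1, h⟩

/-- Super-cores that replace the cores `k` and `k + 1`, reshaped to
`(r_{k-1} q) × (q r_{k+1})` matrices. -/
abbrev SuperCore {d : ℕ} (r : Fin (d + 1) → ℕ) (ι : Type) (k : Fin d) (h : k.val + 1 < d) : Type :=
  Matrix (Fin (r k.castSucc) × ι) (ι × Fin (r (next k h).succ)) ℝ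

/-- The super-core obtained by merging the cores `k` and `k + 1`. -/
def merge {d : ℕ} {r : Fin (d + 1) → ℕ} {ι : Type} (V : Cores r ι) (k : Fin d)
    (h : k.val + 1 < d) : SuperCore r ι k h :=
  Matrix.of fun x y => ∑ β : Fin (r k.succ), V k (x.1, x.2, β) * V (next k h) (β, y.1, y.2)

/-- The contraction of a tuple of cores in which the super-core `W` stands in the place of the
cores `k` and `k + 1`, so that there is no bond index between these two modes. -/
def superContract {d : ℕ} {r : Fin (d + 1) → ℕ} {ι : Type} (V : Cores r ι)
    (k : Fin d) (h : k.val + 1 < d) (W : SuperCore r ι k h) : Coeff ι d (r 0) :=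
  WithLp.toLp 2 fun x => ∑ α : (b : {b : Fin (d + 1) // b ≠ k.succ}) → Fin (r b),
    if α ⟨0, (Fin.succ_ne_zero k).symm⟩ = x.2 then
      W (α ⟨k.castSucc, (Fin.castSucc_lt_succ (i := k)).ne⟩, x.1 k)
          (x.1 (next k h), α ⟨(next k h).succ, by simp [Fin.ext_iff, next]⟩) *
        ∏ m : {m : Fin d // m ≠ k ∧ m ≠ next k h},
          V m (α ⟨m.1.castSucc, fun e => m.2.2 (by simpa [Fin.ext_iff, next] using e)⟩, x.1 m,
            α ⟨m.1.succ, fun e => m.2.1 (by simpa using e)⟩)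
    else 0

/-- The coefficient tensor of the head with the super-core `W` in the place of the cores `k`
and `k + 1`. -/
def superTau {p M d : ℕ} {r : Fin (d + 1) → ℕ} (S : Finset (Fin p))
    (V : Cores r (HeadFeature M S)) (k : Fin d) (h : k.val + 1 < d)
    (W : SuperCore r (HeadFeature M S) k h) : Coeff (Feature p M) d (r 0) :=
  zeroExtend S (superContract V k h W)

/-- `A'` is a truncation of `A` to its `s` leading terms in a singular value decomposition. -/
def IsSVDTruncation {m n : Type} [Fintype m] [Fintype n] (s : ℕ) (A A' : Matrix m n ℝ) : Prop :=
  ∃ (R : ℕ) (x : Fin R → EuclideanSpace ℝ m) (y : Fin R → EuclideanSpace ℝ n) (σ : Fin R → ℝ),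
    Orthonormal ℝ x ∧ Orthonormal ℝ y ∧ Antitone σ ∧ (∀ a, 0 ≤ σ a) ∧
    A = ∑ a, σ a • Matrix.vecMulVec (x a).ofLp (y a).ofLp ∧
    A' = ∑ a : Fin R, if a.val < s then σ a • Matrix.vecMulVec (x a).ofLp (y a).ofLp else 0

/-- `W` is an (untruncated) least-squares update of the super-core at the cores `k`, `k + 1`. -/
def IsSuperLS {p M d N : ℕ} {r : Fin (d + 1) → ℕ} (u : ℤ → Fin p → ℝ) (S : Finset (Fin p))
    (Y : Matrix (Fin N) (Fin (r 0)) ℝ) (V : Cores r (HeadFeature M S)) (k : Fin d)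
    (h : k.val + 1 < d) (W : SuperCore r (HeadFeature M S) k h) : Prop :=
  ∀ W', loss u S Y (superTau S V k h W) ≤ loss u S Y (superTau S V k h W')

/-- `V'` results from `V` and the updated super-core `W` at the cores `k`, `k + 1` by an SVD
truncation of `W` to a rank that the bond admits, followed by a splitting into two cores; the
other cores are kept. -/
def IsTruncatedUpdate {d : ℕ} {r : Fin (d + 1) → ℕ} {ι : Type} [Fintype ι] (V V' : Cores r ι)
    (k : Fin d) (h : k.val + 1 < d) (W : SuperCore r ι k h) : Prop :=
  (∃ s ≤ r k.succ, IsSVDTruncation s W (merge V' k h)) ∧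
    ∀ m, m ≠ k → m ≠ next k h → V' m = V m

/-- The decrease `ΔJ_LS` of the loss by the untruncated update `W` of the super-core. -/
def lsGain {p M d N : ℕ} {r : Fin (d + 1) → ℕ} (u : ℤ → Fin p → ℝ) (S : Finset (Fin p))
    (Y : Matrix (Fin N) (Fin (r 0)) ℝ) (V : Cores r (HeadFeature M S)) (k : Fin d)
    (h : k.val + 1 < d) (W : SuperCore r (HeadFeature M S) k h) : ℝ :=
  loss u S Y (tau S V) - loss u S Y (superTau S V k h W)

/-- The truncation loss: the squared norm of the difference between the predictions with the
super-cores `W` (before truncation) and `W'` (after truncation). -/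
def truncationLoss {p M d : ℕ} {r : Fin (d + 1) → ℕ} (N : ℕ) (u : ℤ → Fin p → ℝ)
    (S : Finset (Fin p)) (V : Cores r (HeadFeature M S)) (k : Fin d)
    (h : k.val + 1 < d) (W W' : SuperCore r (HeadFeature M S) k h) : ℝ :=
  frobSq (designIn M d N u S * mat (superTau S V k h (W - W')))

end THA

end

open THA

/-!
The gradient of `j = L ∘ τ` at `V₀` is `-2 J* (U_Sᵀ R)` for the residual `R = Y - U_S B₀`, which
splits into the omitted dynamics, the projection error and the noise (`hasGradientAt_loss_tau`,
`residual_eq`). Hence `⟨gOmitted, Δ⟩ = -2 ⟨C, J Δ⟩` for all `Δ`, and everything about `gOmitted`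
follows as soon as the image of `J` is known to be the tangent space `T` (`range_fderiv_tau`).

The inclusion of the image in `T` holds because tuples of cores near `V₀` stay in the manifold:
the ranks never exceed `r`, and they are lower semicontinuous. For the converse, let `v` be the
velocity of a curve in the manifold. At each inner bond, the unfolding of `B₀` is the product of a
left interface matrix `L` with independent columns and a right interface matrix `R` with
independent rows. As the ranks along the curve are bounded, the unfolding of `v` maps the kernel
of `R` into the range of `L` (`one_sub_mul_velocity_mulVec_eq_zero`). This is all that is needed to
construct increments of the cores, from left to right, along which `τ` has the velocity `v`
(`exists_increment`): with right inverses `G` of the `R`, the products of `G` with the unfoldings of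
`v` are the prescribed velocities of the matrices `L`.

The claims about updates are linear least squares. The prediction is linear in a single core
(`coreLin`) and in a super-core (`superLin`), so minimizers exist. A nonzero block of the gradient
gives a descent direction within this core (`exists_replaceCore_lt`), and the super-core can imitate
each update of its cores (`superTau_merge`), so the gains are positive. The residual of a minimizer
is orthogonal to the range of the prediction, so by the theorem of Pythagoras any other super-core
costs the squared norm of the difference of the predictions (`loss_sub_loss_eq`), whether or not it
is a truncated singular value decomposition.
-/

namespace THA

/-! ### Contraction of tensor trains by matrix products -/

section Chains

variable {d : ℕ} {r : Fin (d + 1) → ℕ}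

/-- The product `A 0 * A 1 * ⋯` of the first `b` matrices of a chain. -/
def leftProd (A : ∀ k : Fin d, Matrix (Fin (r k.castSucc)) (Fin (r k.succ)) ℝ)
    (b : Fin (d + 1)) : Matrix (Fin (r 0)) (Fin (r b)) ℝ :=
  Fin.induction (motive := fun b => Matrix (Fin (r 0)) (Fin (r b)) ℝ) 1
    (fun k L => L * A k) b

/-- The product of the matrices of a chain from the `b`-th one on, applied to the all-ones
vector. -/
def rightProd (A : ∀ k : Fin d, Matrix (Fin (r k.castSucc)) (Fin (r k.succ)) ℝ)
    (b : Fin (d + 1)) : Fin (r b) → ℝ :=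
  Fin.reverseInduction (motive := fun b => Fin (r b) → ℝ) (fun _ => 1)
    (fun k R => A k *ᵥ R) b

variable (A : ∀ k : Fin d, Matrix (Fin (r k.castSucc)) (Fin (r k.succ)) ℝ)

@[simp] lemma leftProd_zero : leftProd A 0 = 1 := rfl

lemma leftProd_succ (k : Fin d) : leftProd A k.succ = leftProd A k.castSucc * A k := rfl

@[simp] lemma rightProd_last : rightProd A (Fin.last d) = fun _ => 1 := by
  simp [rightProd]

lemma rightProd_castSucc (k : Fin d) :
    rightProd A k.castSucc = A k *ᵥ rightProd A k.succ := by
  simp [rightProd]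

lemma leftProd_mulVec_rightProd (b : Fin (d + 1)) :
    leftProd A b *ᵥ rightProd A b = rightProd A 0 := by
  induction b using Fin.induction with
  | zero => simp
  | succ k ih => rw [← ih, leftProd_succ, rightProd_castSucc, Matrix.mulVec_mulVec]

variable {A} in
lemma leftProd_congr {A' : ∀ k : Fin d, Matrix (Fin (r k.castSucc)) (Fin (r k.succ)) ℝ}
    (b : Fin (d + 1)) (h : ∀ k : Fin d, k.val < b.val → A k = A' k) :
    leftProd A b = leftProd A' b := by
  induction b using Fin.induction with
  | zero => rfl
  | succ k ih =>
    rw [leftProd_succ, leftProd_succ, h k (by simp),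
      ih fun m hm => h m (by simp at hm ⊢; omega)]

variable {A} in
lemma rightProd_congr {A' : ∀ k : Fin d, Matrix (Fin (r k.castSucc)) (Fin (r k.succ)) ℝ}
    (b : Fin (d + 1)) (h : ∀ k : Fin d, ¬ k.val < b.val → A k = A' k) :
    rightProd A b = rightProd A' b := by
  induction b using Fin.reverseInduction with
  | last => simp
  | cast k ih =>
    rw [rightProd_castSucc, rightProd_castSucc, h k (by simp),
      ih fun m hm => h m (by simp at hm ⊢; omega)]

lemma rightProd_tail {r : Fin (d + 2) → ℕ}
    (A : ∀ k : Fin (d + 1), Matrix (Fin (r k.castSucc)) (Fin (r k.succ)) ℝ) (b : Fin (d + 1)) :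
    rightProd (r := fun b => r b.succ) (fun k => A k.succ) b = rightProd A b.succ := by
  induction b using Fin.reverseInduction with
  | last =>
    rw [rightProd_last]
    exact (rightProd_last A).symm
  | cast k ih =>
    rw [rightProd_castSucc, ih]
    exact (rightProd_castSucc A k.succ).symm

end Chains

/-- Summing over all bond indices of a chain amounts to multiplying its matrices. -/
lemma sum_paths_eq_rightProd {d : ℕ} {r : Fin (d + 1) → ℕ}
    (A : ∀ k : Fin d, Matrix (Fin (r k.castSucc)) (Fin (r k.succ)) ℝ) (a : Fin (r 0)) :
    (∑ α : (b : Fin (d + 1)) → Fin (r b),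
      if α 0 = a then ∏ k : Fin d, A k (α k.castSucc) (α k.succ) else 0) = rightProd A 0 a := by
  induction d with
  | zero =>
    rw [Finset.sum_eq_single (fun b => (Fin.fin_one_eq_zero b ▸ a : Fin (r b)))]
    · have : rightProd A 0 = fun _ => 1 := rightProd_last A
      simp [this]
    · intro α _ hα
      rw [if_neg]
      rintro rfl
      apply hα
      funext b
      obtain rfl := Fin.fin_one_eq_zero b
      rfl
    · simp
  | succ d ih =>
    rw [← (Fin.consEquiv fun b => Fin (r b)).sum_comp, Fintype.sum_prod_type,
      Finset.sum_eq_single a]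
    · have h0 : rightProd A 0 = A 0 *ᵥ rightProd A (Fin.succ 0) := rightProd_castSucc A 0
      rw [h0, ← rightProd_tail A 0]
      change _ = ∑ b, A 0 a b * rightProd (r := fun b => r b.succ) (fun k => A k.succ) 0 b
      simp only [← ih]
      simp only [Finset.mul_sum]
      rw [Finset.sum_comm]
      refine Finset.sum_congr rfl fun β _ => ?_
      rw [Finset.sum_eq_single (β 0)]
      · rw [if_pos rfl]
        simp [Fin.prod_univ_succ, Fin.consEquiv]
      · intro b _ hb
        rw [if_neg (Ne.symm hb), mul_zero]
      · exact fun h => absurd (Finset.mem_univ _) h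
    · intro b _ hb
      refine Finset.sum_eq_zero fun β _ => if_neg ?_
      simpa [Fin.consEquiv] using hb
    · simp

section Contraction

variable {d : ℕ} {r : Fin (d + 1) → ℕ} {ι : Type}

/-- The chain of matrices that a tuple of cores provides for the modes `x`. -/
def slices (V : Cores r ι) (x : Fin d → ι) (k : Fin d) :
    Matrix (Fin (r k.castSucc)) (Fin (r k.succ)) ℝ :=
  Matrix.of fun α β => V k (α, x k, β)

lemma contract_apply [Fintype ι] (V : Cores r ι) (x : Fin d → ι) (a : Fin (r 0))
    (b : Fin (d + 1)) :
    contract V (x, a) = (leftProd (slices V x) b *ᵥ rightProd (slices V x) b) a := by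
  rw [leftProd_mulVec_rightProd, ← sum_paths_eq_rightProd]
  rfl

/-- Modes that are glued from a left part and a right part at the bond `b`. -/
def glue (b : ℕ) (y : {m : Fin d // m.val < b} → ι) (z : {m : Fin d // ¬ m.val < b} → ι) :
    Fin d → ι :=
  fun m => if h : m.val < b then y ⟨m, h⟩ else z ⟨m, h⟩

lemma glue_left (b : ℕ) (y : {m : Fin d // m.val < b} → ι)
    (z : {m : Fin d // ¬ m.val < b} → ι) :
    (fun m : {m : Fin d // m.val < b} => glue b y z m) = y := by
  funext m
  simp [glue, m.2]

lemma glue_right (b : ℕ) (y : {m : Fin d // m.val < b} → ι)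
    (z : {m : Fin d // ¬ m.val < b} → ι) :
    (fun m : {m : Fin d // ¬ m.val < b} => glue b y z m) = z := by
  funext m
  simp [glue, m.2]

/-- The interface matrix of a tuple of cores to the left of the bond `b`. The default modes to
the right of the bond have no influence on it. -/
def leftMat [Inhabited ι] (V : Cores r ι) (b : Fin (d + 1)) :
    Matrix (Fin (r 0) × ({m : Fin d // m.val < b} → ι)) (Fin (r b)) ℝ :=
  Matrix.of fun y α =>
    leftProd (slices V fun m => if h : m.val < b then y.2 ⟨m, h⟩ else default) b y.1 α

/-- The interface matrix of a tuple of cores to the right of the bond `b`. The default modes to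
the left of the bond have no influence on it. -/
def rightMat [Inhabited ι] (V : Cores r ι) (b : Fin (d + 1)) :
    Matrix (Fin (r b)) ({m : Fin d // ¬ m.val < b} → ι) ℝ :=
  Matrix.of fun α z =>
    rightProd (slices V fun m => if h : m.val < b then default else z ⟨m, h⟩) b α

variable [Inhabited ι]

lemma leftMat_apply (V : Cores r ι) (b : Fin (d + 1)) (x : Fin d → ι) (a : Fin (r 0))
    (α : Fin (r b)) :
    leftMat V b (a, fun m => x m) α = leftProd (slices V x) b a α := by
  simp only [leftMat, Matrix.of_apply]
  rw [leftProd_congr b]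
  intro k hk
  simp [slices, hk]

lemma rightMat_apply (V : Cores r ι) (b : Fin (d + 1)) (x : Fin d → ι) (α : Fin (r b)) :
    rightMat V b α (fun m => x m) = rightProd (slices V x) b α := by
  simp only [rightMat, Matrix.of_apply]
  rw [rightProd_congr b]
  intro k hk
  simp [slices, hk]

lemma unfold_contract [Fintype ι] (V : Cores r ι) (b : Fin (d + 1)) :
    unfold (contract V) b = leftMat V b * rightMat V b := by
  ext ⟨a, y⟩ z
  change contract V (glue b y z, a) = _
  rw [contract_apply V _ a b, Matrix.mul_apply, Matrix.mulVec, dotProduct]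
  refine Finset.sum_congr rfl fun α _ => ?_
  rw [← leftMat_apply, ← rightMat_apply, glue_left, glue_right]

end Contraction

/-! ### Rank and curves of matrices of bounded rank -/

section Rank

variable {m n : Type} [Fintype m] [Fintype n] {s : ℕ}

lemma exists_right_inverse_of_le_rank (R : Matrix (Fin s) n ℝ) (h : s ≤ R.rank) :
    ∃ G : Matrix n (Fin s) ℝ, R * G = 1 := by
  rw [← Matrix.mulVec_surjective_iff_exists_right_inverse]
  have h1 : LinearMap.range R.mulVecLin = ⊤ :=
    Submodule.eq_top_of_finrank_eq <|
      le_antisymm (Submodule.finrank_le _) (by rw [Module.finrank_fin_fun]; exact h)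
  exact LinearMap.range_eq_top.1 h1

lemma exists_left_inverse_of_le_rank (L : Matrix m (Fin s) ℝ) (h : s ≤ L.rank) :
    ∃ H : Matrix (Fin s) m ℝ, H * L = 1 := by
  obtain ⟨G, hG⟩ := exists_right_inverse_of_le_rank Lᵀ (by rwa [Matrix.rank_transpose])
  exact ⟨Gᵀ, by rw [← Matrix.transpose_inj, Matrix.transpose_mul]; simpa using hG⟩

/-- The rank is lower semicontinuous. -/
lemma eventually_le_rank {X : Type} {l : Filter X} {A : X → Matrix m n ℝ}
    {L : Matrix m (Fin s) ℝ} {R : Matrix (Fin s) n ℝ} {H : Matrix (Fin s) m ℝ}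
    {G : Matrix n (Fin s) ℝ} (hH : H * L = 1) (hG : R * G = 1)
    (hA : Filter.Tendsto A l (𝓝 (L * R))) : ∀ᶠ x in l, s ≤ (A x).rank := by
  have h1 : Filter.Tendsto (fun x => (H * A x * G).det) l (𝓝 (H * (L * R) * G).det) :=
    ((by fun_prop : Continuous fun B : Matrix m n ℝ => (H * B * G).det).tendsto _).comp hA
  have h2 : H * (L * R) * G = 1 := by
    rw [← Matrix.mul_assoc, hH, Matrix.one_mul, hG]
  rw [h2, Matrix.det_one] at h1
  filter_upwards [h1.eventually_ne one_ne_zero] with x hx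
  have h3 : (H * A x * G).rank = s := by
    rw [Matrix.rank_of_isUnit _ ((Matrix.isUnit_iff_isUnit_det _).2 hx.isUnit)]
    simp
  calc s = (H * A x * G).rank := h3.symm
    _ ≤ (H * A x).rank := Matrix.rank_mul_le_left _ _
    _ ≤ (A x).rank := Matrix.rank_mul_le_right _ _

/-- The velocity of a curve of matrices of rank at most `s` vanishes between the left kernel and
the kernel of the starting point, if the latter has rank `s`: a bordered `s × s` minor of the
curve has determinant zero, and so has the limit of these minors after division of the border by
the time. -/
lemma mul_velocity_mul_eq_zero {A : ℝ → Matrix m n ℝ} {A' : Matrix m n ℝ}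
    {L : Matrix m (Fin s) ℝ} {R : Matrix (Fin s) n ℝ} {H : Matrix (Fin s) m ℝ}
    {G : Matrix n (Fin s) ℝ} (hH : H * L = 1) (hG : R * G = 1) (h0 : A 0 = L * R)
    (hrank : ∀ᶠ t in 𝓝 (0 : ℝ), (A t).rank ≤ s)
    (hA : ∀ x y, HasDerivAt (fun t => A t x y) (A' x y) 0)
    {v : Matrix Unit m ℝ} (hv : v * L = 0) {w : Matrix n Unit ℝ} (hw : R * w = 0) :
    v * A' * w = 0 := by
  have hA0 : Filter.Tendsto A (𝓝[≠] 0) (𝓝 (L * R)) := by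
    rw [← h0]
    refine tendsto_pi_nhds.2 fun x => tendsto_pi_nhds.2 fun y => ?_
    exact (hA x y).continuousAt.tendsto.mono_left nhdsWithin_le_nhds
  have hA1 : Filter.Tendsto (fun t => t⁻¹ • (A t - A 0)) (𝓝[≠] 0) (𝓝 A') := by
    refine tendsto_pi_nhds.2 fun x => tendsto_pi_nhds.2 fun y => ?_
    have := (hA x y).tendsto_slope
    simpa [slope_fun_def] using this
  have hvA : v * A 0 = 0 := by rw [h0, ← Matrix.mul_assoc, hv, Matrix.zero_mul]
  have hcont : Continuous fun B : Matrix m n ℝ × Matrix m n ℝ =>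
      (Matrix.fromBlocks (H * B.1 * G) (H * B.1 * w) (v * B.2 * G) (v * B.2 * w)).det := by
    fun_prop
  have key := (hcont.tendsto (L * R, A')).comp (hA0.prodMk_nhds hA1)
  simp only [Function.comp_def] at key
  have h1 : H * (L * R) * G = 1 := by
    rw [← Matrix.mul_assoc, hH, Matrix.one_mul, hG]
  have h2 : H * (L * R) * w = 0 := by
    rw [Matrix.mul_assoc, Matrix.mul_assoc, hw, Matrix.mul_zero, Matrix.mul_zero]
  rw [h1, h2, Matrix.det_fromBlocks_zero₁₂, Matrix.det_one, one_mul, Matrix.det_unique] at key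
  have hzero : ∀ᶠ t in 𝓝[≠] (0 : ℝ), (0 : ℝ) = (Matrix.fromBlocks (H * A t * G) (H * A t * w)
      (v * (t⁻¹ • (A t - A 0)) * G) (v * (t⁻¹ • (A t - A 0)) * w)).det := by
    filter_upwards [hrank.filter_mono nhdsWithin_le_nhds] with t ht
    by_contra hne
    have e : Matrix.fromBlocks (H * A t * G) (H * A t * w)
        (v * (t⁻¹ • (A t - A 0)) * G) (v * (t⁻¹ • (A t - A 0)) * w) =
        Matrix.fromRows H (t⁻¹ • v) * A t * Matrix.fromCols G w := by
      have : v * (t⁻¹ • (A t - A 0)) = t⁻¹ • v * A t := by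
        rw [Matrix.mul_smul, Matrix.mul_sub, hvA, sub_zero, Matrix.smul_mul]
      rw [this, Matrix.fromRows_mul, Matrix.fromRows_mul_fromCols]
    have hr := Matrix.rank_of_isUnit _
      ((Matrix.isUnit_iff_isUnit_det _).2 (Ne.isUnit (Ne.symm hne)))
    rw [e] at hr
    have h3 := (Matrix.rank_mul_le_left (Matrix.fromRows H (t⁻¹ • v) * A t)
      (Matrix.fromCols G w)).trans (Matrix.rank_mul_le_right _ _)
    rw [hr] at h3
    simp at h3
    omega
  have := tendsto_nhds_unique key (tendsto_const_nhds.congr' hzero)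
  ext ⟨⟩ ⟨⟩
  simpa using this

/-- The velocity of a curve of matrices of rank at most `s` maps the kernel of the starting point
`L * R` into the range of `L`. -/
lemma one_sub_mul_velocity_mulVec_eq_zero [DecidableEq m] {A : ℝ → Matrix m n ℝ} {A' : Matrix m n ℝ}
    {L : Matrix m (Fin s) ℝ} {R : Matrix (Fin s) n ℝ} {H : Matrix (Fin s) m ℝ}
    {G : Matrix n (Fin s) ℝ} (hH : H * L = 1) (hG : R * G = 1) (h0 : A 0 = L * R)
    (hrank : ∀ᶠ t in 𝓝 (0 : ℝ), (A t).rank ≤ s)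
    (hA : ∀ x y, HasDerivAt (fun t => A t x y) (A' x y) 0) {w : n → ℝ} (hw : R *ᵥ w = 0) :
    (1 - L * H) *ᵥ (A' *ᵥ w) = 0 := by
  funext x
  have hv : Matrix.replicateRow Unit ((1 - L * H : Matrix m m ℝ) x) * L = 0 := by
    have : (1 - L * H : Matrix m m ℝ) * L = 0 := by
      rw [Matrix.sub_mul, Matrix.mul_assoc, hH, Matrix.one_mul, Matrix.mul_one, sub_self]
    ext i y
    exact congrFun (congrFun this x) y
  have hw' : R * Matrix.replicateCol Unit w = 0 := by
    ext y i
    exact congrFun hw y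
  have := mul_velocity_mul_eq_zero hH hG h0 hrank hA hv hw'
  rw [Matrix.mul_assoc] at this
  exact congrFun (congrFun this ()) ()

end Rank

/-! ### Increments of the cores with a prescribed velocity -/

/-- Product rule for the partial products of a chain of matrices that moves along a line. -/
lemma hasDerivAt_leftProd {d : ℕ} {r : Fin (d + 1) → ℕ}
    (A B : ∀ k : Fin d, Matrix (Fin (r k.castSucc)) (Fin (r k.succ)) ℝ)
    (D : ∀ b : Fin (d + 1), Matrix (Fin (r 0)) (Fin (r b)) ℝ) (h0 : D 0 = 0)
    (hs : ∀ k : Fin d, D k.succ = D k.castSucc * A k + leftProd A k.castSucc * B k)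
    (b : Fin (d + 1)) (a : Fin (r 0)) (β : Fin (r b)) :
    HasDerivAt (fun t : ℝ => leftProd (fun k => A k + t • B k) b a β) (D b a β) 0 := by
  induction b using Fin.induction with
  | zero => simpa [h0] using hasDerivAt_const (0 : ℝ) ((1 : Matrix (Fin (r 0)) (Fin (r 0)) ℝ) a β)
  | succ k ih =>
    have hB : ∀ α, HasDerivAt (fun t : ℝ => (A k + t • B k) α β) (B k α β) 0 := fun α => by
      simpa using ((hasDerivAt_id (0 : ℝ)).mul_const (B k α β)).const_add (A k α β)
    have := HasDerivAt.fun_sum (u := Finset.univ) fun α _ => (ih α).mul (hB α)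
    refine this.congr_deriv ?_
    rw [hs]
    simp [Matrix.mul_apply, Finset.sum_add_distrib]

section Tail

variable {d : ℕ} {ι : Type}

/-- Prepend the mode `k` to the modes after it. -/
def tailCons (k : Fin d) (i : ι) (z : {m : Fin d // ¬ m.val < k.succ.val} → ι) :
    {m : Fin d // ¬ m.val < k.castSucc.val} → ι :=
  fun m => if h : m.1 = k then i else
    z ⟨m.1, by have := m.2; rw [Fin.ext_iff] at h; simp at this ⊢; omega⟩

/-- Forget the first mode `k`. -/
def tailTail (k : Fin d) (z : {m : Fin d // ¬ m.val < k.castSucc.val} → ι) :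
    {m : Fin d // ¬ m.val < k.succ.val} → ι :=
  fun m => z ⟨m.1, by have := m.2; simp at this ⊢; omega⟩

/-- The first of the modes that follow the bond before the mode `k`. -/
abbrev tailHead (k : Fin d) : {m : Fin d // ¬ m.val < k.castSucc.val} := ⟨k, by simp⟩

lemma tailCons_head (k : Fin d) (i : ι) (z : {m : Fin d // ¬ m.val < k.succ.val} → ι) :
    tailCons k i z (tailHead k) = i := by
  simp [tailCons]

lemma tailTail_tailCons (k : Fin d) (i : ι) (z : {m : Fin d // ¬ m.val < k.succ.val} → ι) :
    tailTail k (tailCons k i z) = z := by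
  funext m
  have : m.1 ≠ k := by
    rintro h
    have := m.2
    rw [h] at this
    simp at this
  simp [tailTail, tailCons, this]

lemma tailCons_tailTail (k : Fin d) (z : {m : Fin d // ¬ m.val < k.castSucc.val} → ι) :
    tailCons k (z (tailHead k)) (tailTail k z) = z := by
  funext m
  by_cases h : m.1 = k
  · simp only [tailCons, h, dite_true]
    congr 1
    exact Subtype.ext h.symm
  · simp [tailTail, tailCons, h]

lemma sum_tail [Fintype ι] [DecidableEq ι] (k : Fin d) (i : ι)
    (f : ({m : Fin d // ¬ m.val < k.castSucc.val} → ι) → ℝ) :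
    (∑ z, if z (tailHead k) = i then f z else 0) = ∑ z, f (tailCons k i z) := by
  rw [← Finset.sum_filter]
  symm
  refine Finset.sum_nbij' (tailCons k i) (tailTail k) ?_ ?_ ?_ ?_ ?_
  · intro z _
    simp [tailCons_head]
  · simp
  · intro z _
    exact tailTail_tailCons k i z
  · intro z hz
    rw [← (Finset.mem_filter.1 hz).2]
    exact tailCons_tailTail k z
  · simp

lemma glue_tailCons (k : Fin d) (x : Fin d → ι) (z : {m : Fin d // ¬ m.val < k.succ.val} → ι) :
    glue k.castSucc.val (fun m => x m) (tailCons k (x k) z) =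
      glue k.succ.val (fun m => x m) z := by
  funext m
  rcases lt_trichotomy m.val k.val with h | h | h
  · simp [glue, h, h.trans (Nat.lt_succ_self _)]
  · obtain rfl := Fin.ext h
    simp [glue, tailCons]
  · have h1 : ¬ m.val < k.val := by omega
    have h2 : ¬ m.val < k.val + 1 := by omega
    have h3 : m ≠ k := fun e => by simp [e] at h
    simp [glue, tailCons, h1, h2, h3]

end Tail

section Tangent

variable {d : ℕ} {r : Fin (d + 1) → ℕ} {ι : Type} [Inhabited ι]

lemma rightMat_castSucc_tailCons (V : Cores r ι) (k : Fin d) (i : ι)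
    (z : {m : Fin d // ¬ m.val < k.succ.val} → ι) (γ : Fin (r k.castSucc)) :
    rightMat V k.castSucc γ (tailCons k i z) =
      ∑ δ, V k (γ, i, δ) * rightMat V k.succ δ z := by
  have h1 := rightMat_apply V k.castSucc
    (glue k.succ.val (fun _ => i) z) γ
  have h2 := fun δ => rightMat_apply V k.succ (glue k.succ.val (fun _ => i) z) δ
  have e1 : (fun m : {m : Fin d // ¬ m.val < k.castSucc.val} =>
      glue k.succ.val (fun _ => i) z m) = tailCons k i z := by
    rw [← glue_tailCons k (fun _ => i) z, glue_right]
  simp only [glue_right] at h2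
  rw [← e1, h1, rightProd_castSucc]
  change ∑ δ : Fin (r k.succ), _ * _ = _
  refine Finset.sum_congr rfl fun δ _ => ?_
  rw [h2]
  simp [slices, glue]

/-- A direction `v` that respects the kernels of all unfoldings, up to the ranges of the left
interface matrices, is the velocity of the contraction along a line of cores. The increments of
the cores are found from left to right: if `G b` is a right inverse of the right interface matrix
at the bond `b`, then `unfold v b * G b` has to be the velocity of the left interface matrix, and
the product rule determines the increment of each core up to a linear system with the left
interface matrix, which is solvable by the hypothesis. -/
lemma exists_increment [Fintype ι] (hd : 1 ≤ d) (hr : r (Fin.last d) = 1) (V : Cores r ι)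
    (v : Coeff ι d (r 0))
    (hright : ∀ b : Fin (d + 1), b ≠ 0 → b ≠ Fin.last d →
      ∃ G : Matrix ({m : Fin d // ¬ m.val < b.val} → ι) (Fin (r b)) ℝ, rightMat V b * G = 1)
    (hleft : ∀ b : Fin (d + 1), b ≠ 0 → b ≠ Fin.last d → ∀ w, rightMat V b *ᵥ w = 0 →
      ∃ c, unfold v b *ᵥ w = leftMat V b *ᵥ c) :
    ∃ Δ : Cores r ι, ∀ x a,
      HasDerivAt (fun t : ℝ => contract (V + t • Δ) (x, a)) (v (x, a)) 0 := by
  classical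
  have hlast0 : Fin.last d ≠ 0 := by
    intro h
    have := congrArg Fin.val h
    simp at this
    omega
  have hempty : IsEmpty {m : Fin d // ¬ m.val < (Fin.last d).val} :=
    ⟨fun m => m.2 (by simp)⟩
  have hempty0 : IsEmpty {m : Fin d // m.val < (0 : Fin (d + 1)).val} :=
    ⟨fun m => by simpa using m.2⟩
  have hsub : Subsingleton (Fin (r (Fin.last d))) := by rw [hr]; infer_instance
  -- Only the value `0` at the first bond, where the left interface matrix does not move, and the
  -- value `1` at the last bond, where it is the whole tensor, are not provided by `hright`.
  have hG : ∀ b : Fin (d + 1), ∃ G : Matrix ({m : Fin d // ¬ m.val < b.val} → ι) (Fin (r b)) ℝ,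
      (b = 0 → G = 0) ∧ (b ≠ 0 → rightMat V b * G = 1) ∧
        (b = Fin.last d → G = Matrix.of fun _ _ => 1) := by
    intro b
    by_cases h0 : b = 0
    · subst h0
      exact ⟨0, fun _ => rfl, fun h => absurd rfl h, fun h => absurd h.symm hlast0⟩
    by_cases hl : b = Fin.last d
    · subst hl
      refine ⟨Matrix.of fun _ _ => 1, fun h => absurd h h0, fun _ => ?_, fun _ => rfl⟩
      ext α β
      obtain rfl := Subsingleton.elim α β
      simp [Matrix.mul_apply, rightMat]
    · obtain ⟨G, hG⟩ := hright b h0 hl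
      exact ⟨G, fun h => absurd h h0, fun _ => hG, fun h => absurd h hl⟩
  choose G hG0 hG1 hGl using hG
  -- the prescribed velocities of the left interface matrices
  let D : (Fin d → ι) → ∀ b : Fin (d + 1), Matrix (Fin (r 0)) (Fin (r b)) ℝ := fun x b =>
    Matrix.of fun a α => (unfold v b * G b) (a, fun m => x m) α
  have hrange : ∀ b : Fin (d + 1), b ≠ Fin.last d → ∀ w, (b ≠ 0 → rightMat V b *ᵥ w = 0) →
      ∃ c, unfold v b *ᵥ w = leftMat V b *ᵥ c := by
    intro b hb w hw
    by_cases h0 : b = 0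
    · -- the left interface matrix at the first bond is the identity
      subst h0
      refine ⟨fun α => (unfold v (0 : Fin (d + 1)) *ᵥ w) (α, fun _ => default), ?_⟩
      funext ⟨a, y⟩
      have : y = fun _ => default := Subsingleton.elim _ _
      rw [this]
      change _ = ∑ α, (1 : Matrix (Fin (r 0)) (Fin (r 0)) ℝ) a α * _
      simp only [Matrix.one_apply, ite_mul, one_mul, zero_mul, Finset.sum_ite_eq,
        Finset.mem_univ, if_true]
    · exact hleft b h0 hb w (hw h0)
  have hΔ : ∀ k : Fin d, ∃ Δk : EuclideanSpace ℝ (Fin (r k.castSucc) × ι × Fin (r k.succ)),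
      ∀ x, D x k.succ = D x k.castSucc * slices V x k +
        leftProd (slices V x) k.castSucc * Matrix.of fun α β => Δk (α, x k, β) := by
    intro k
    -- Applying the unfolding of `v` to `w i α` gives the defect of the product rule. Away
    -- from the first bond, `w i α` is in the kernel of the right interface matrix, since both of
    -- its terms are mapped to `V k (·, i, α)`.
    let w : ι → Fin (r k.succ) → ({m : Fin d // ¬ m.val < k.castSucc.val} → ι) → ℝ :=
      fun i α z => (if z (tailHead k) = i then G k.succ (tailTail k z) α else 0) -
        ∑ β, G k.castSucc z β * V k (β, i, α)
    have hw : ∀ i α, k.castSucc ≠ 0 → rightMat V k.castSucc *ᵥ w i α = 0 := by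
      intro i α hk
      funext γ
      have h1 : ∑ z, rightMat V k.castSucc γ z *
          (if z (tailHead k) = i then G k.succ (tailTail k z) α else 0) = V k (γ, i, α) := by
        simp only [mul_ite, mul_zero]
        rw [sum_tail k i fun z => rightMat V k.castSucc γ z * G k.succ (tailTail k z) α]
        simp only [tailTail_tailCons, rightMat_castSucc_tailCons, Finset.sum_mul, mul_assoc]
        rw [Finset.sum_comm]
        simp only [← Finset.mul_sum]
        have h := fun δ => congrFun (congrFun (hG1 k.succ (Fin.succ_ne_zero k)) δ) α
        simp only [Matrix.mul_apply] at h
        simp only [h, Matrix.one_apply, mul_ite, mul_one, mul_zero, Finset.sum_ite_eq',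
          Finset.mem_univ, if_true]
      have h2 : ∑ z, rightMat V k.castSucc γ z * ∑ β, G k.castSucc z β * V k (β, i, α) =
          V k (γ, i, α) := by
        simp only [Finset.mul_sum, ← mul_assoc]
        rw [Finset.sum_comm]
        simp only [← Finset.sum_mul]
        have h := fun β => congrFun (congrFun (hG1 k.castSucc hk) γ) β
        simp only [Matrix.mul_apply] at h
        simp only [h, Matrix.one_apply, ite_mul, one_mul, zero_mul, Finset.sum_ite_eq,
          Finset.mem_univ, if_true]
      simp only [Matrix.mulVec, dotProduct, w, mul_sub, Finset.sum_sub_distrib, h1, h2, sub_self,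
        Pi.zero_apply]
    choose c hc using fun i α => hrange k.castSucc (Fin.castSucc_lt_last k).ne (w i α) (hw i α)
    refine ⟨WithLp.toLp 2 fun y => c y.2.1 y.2.2 y.1, fun x => ?_⟩
    ext a α
    have h1 := congrFun (hc (x k) α) (a, fun m => x m)
    have h2 : (unfold v k.castSucc *ᵥ w (x k) α) (a, fun m => x m) =
        D x k.succ a α - (D x k.castSucc * slices V x k) a α := by
      simp only [Matrix.mulVec, dotProduct, w, mul_sub, Finset.sum_sub_distrib]
      congr 1
      · simp only [mul_ite, mul_zero]
        rw [sum_tail k (x k) fun z =>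
          unfold v k.castSucc (a, fun m => x m) z * G k.succ (tailTail k z) α]
        simp only [tailTail_tailCons, D, Matrix.of_apply, Matrix.mul_apply]
        refine Finset.sum_congr rfl fun z _ => ?_
        congr 1
        change v (glue k.castSucc.val _ _, a) = v (glue k.succ.val _ _, a)
        rw [glue_tailCons]
      · simp only [Finset.mul_sum, D, Matrix.of_apply, Matrix.mul_apply, Finset.sum_mul, slices,
          ← mul_assoc]
        rw [Finset.sum_comm]
    rw [h2] at h1
    rw [Matrix.add_apply, ← sub_eq_iff_eq_add', h1]
    simp only [Matrix.mulVec, dotProduct, Matrix.mul_apply, Matrix.of_apply, leftMat_apply]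
  choose Δ hΔ using hΔ
  refine ⟨WithLp.toLp 2 Δ, fun x a => ?_⟩
  have hD0 : D x 0 = 0 := by
    ext a α
    simp only [D, hG0 0 rfl, Matrix.mul_zero, Matrix.of_apply, Matrix.zero_apply]
  have hder := fun β => hasDerivAt_leftProd (slices V x) (slices (WithLp.toLp 2 Δ) x) (D x) hD0
    (fun k => hΔ k x) (Fin.last d) a β
  have hsum := HasDerivAt.fun_sum (u := Finset.univ) fun β _ => hder β
  have hfun : (fun t : ℝ => contract (V + t • (WithLp.toLp 2 Δ : Cores r ι)) (x, a)) = fun t =>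
      ∑ β, leftProd (fun k => slices V x k + t • slices (WithLp.toLp 2 Δ) x k)
        (Fin.last d) a β := by
    funext t
    rw [contract_apply _ x a (Fin.last d), rightProd_last]
    have e : slices (V + t • (WithLp.toLp 2 Δ : Cores r ι)) x =
        fun k => slices V x k + t • slices (WithLp.toLp 2 Δ) x k := by
      funext k
      ext α β
      simp [slices]
    rw [e]
    simp [Matrix.mulVec, dotProduct]
  have hDl : ∀ β, D x (Fin.last d) a β = v (x, a) := by
    intro β
    simp only [D, Matrix.of_apply, Matrix.mul_apply, hGl _ rfl, mul_one, Fintype.sum_unique]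
    have hglue : ∀ z, glue (Fin.last d).val (fun m => x m) z = x :=
      fun z => funext fun m => by simp [glue]
    exact congrArg (fun y => v (y, a)) (hglue _)
  rw [hfun]
  refine hsum.congr_deriv ?_
  simp only [hDl, Finset.sum_const, Finset.card_univ, Fintype.card_fin, hr, one_smul]

end Tangent

/-! ### The tangent space of the manifold of tensor trains -/

section Head

variable {p M d : ℕ} {r : Fin (d + 1) → ℕ} {S : Finset (Fin p)}

/-- Extension of the cores of a head to all features, by zero. -/
def extendCores (V : Cores r (HeadFeature M S)) : Cores r (Feature p M) :=
  WithLp.toLp 2 fun k => WithLp.toLp 2 fun y =>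
    if h : Included S y.2.1 then V k (y.1, ⟨y.2.1, h⟩, y.2.2) else 0

/-- Restriction of cores to the features of a head. -/
def restrictCores (S : Finset (Fin p)) (V : Cores r (Feature p M)) :
    Cores r (HeadFeature M S) :=
  WithLp.toLp 2 fun k => WithLp.toLp 2 fun y => V k (y.1, y.2.1.1, y.2.2)

lemma tau_apply_of_included (V : Cores r (HeadFeature M S)) {x : Fin d → Feature p M}
    (hx : ∀ m, Included S (x m)) (a : Fin (r 0)) :
    tau S V (x, a) = contract V (fun m => ⟨x m, hx m⟩, a) :=
  dif_pos hx

lemma tau_apply_of_not_included (V : Cores r (HeadFeature M S)) {x : Fin d → Feature p M}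
    (hx : ¬ ∀ m, Included S (x m)) (a : Fin (r 0)) : tau S V (x, a) = 0 :=
  dif_neg hx

lemma tau_eq_contract_extendCores (V : Cores r (HeadFeature M S)) :
    tau S V = contract (extendCores V) := by
  ext ⟨x, a⟩
  by_cases hx : ∀ m, Included S (x m)
  · rw [tau_apply_of_included V hx]
    simp [contract, extendCores, hx]
  · rw [tau_apply_of_not_included V hx]
    obtain ⟨m, hm⟩ := not_forall.1 hx
    symm
    refine Finset.sum_eq_zero fun α _ => ?_
    rw [Finset.prod_eq_zero (Finset.mem_univ m) (by simp [extendCores, hm]), ite_self]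

/-- On the monomials of the head, the increments of the extended cores at features outside `S` have
no influence. -/
lemma tau_add_smul_restrictCores (V : Cores r (HeadFeature M S)) (Δ : Cores r (Feature p M))
    (t : ℝ) {x : Fin d → Feature p M} (hx : ∀ m, Included S (x m)) (a : Fin (r 0)) :
    tau S (V + t • restrictCores S Δ) (x, a) = contract (extendCores V + t • Δ) (x, a) := by
  rw [tau_apply_of_included _ hx]
  simp [contract, extendCores, restrictCores, hx]

lemma contDiff_tau : ContDiff ℝ ∞ (tau (M := M) (r := r) S) := by
  rw [contDiff_euclidean]
  rintro ⟨x, a⟩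
  by_cases hx : ∀ m, Included S (x m)
  · simp only [tau_apply_of_included _ hx, contract]
    refine ContDiff.sum fun α _ => ?_
    split_ifs
    · refine contDiff_prod fun k _ => ?_
      fun_prop
    · exact contDiff_const
  · simp only [tau_apply_of_not_included _ hx]
    exact contDiff_const

lemma mask_mul_mat_eq_iff {l : ℕ} (B : Coeff (Feature p M) d l) :
    mask M d S * mat B = mat B ↔ ∀ x a, (¬ ∀ m, Included S (x m)) → B (x, a) = 0 := by
  rw [← Matrix.ext_iff]
  refine forall_congr' fun x => forall_congr' fun a => ?_
  by_cases hx : ∀ m, Included S (x m) <;> simp [mask, Matrix.diagonal_mul, mat, hx, eq_comm]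

lemma mask_mul_mat_tau (V : Cores r (HeadFeature M S)) :
    mask M d S * mat (tau S V) = mat (tau S V) :=
  (mask_mul_mat_eq_iff _).2 fun _ a hx => tau_apply_of_not_included V hx a

/-- The default feature is the constant. -/
instance : Inhabited (Feature p M) := ⟨none⟩

lemma unfold_tau (V : Cores r (HeadFeature M S)) (b : Fin (d + 1)) :
    unfold (tau S V) b = leftMat (extendCores V) b * rightMat (extendCores V) b := by
  rw [tau_eq_contract_extendCores, unfold_contract]

lemma rank_unfold_tau_le (V : Cores r (HeadFeature M S)) (b : Fin (d + 1)) :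
    (unfold (tau S V) b).rank ≤ r b := by
  rw [unfold_tau]
  refine (Matrix.rank_mul_le_left _ _).trans ?_
  simpa using Matrix.rank_le_card_width (leftMat (extendCores V) b)

lemma tau_mem_ttBounded (V : Cores r (HeadFeature M S)) : tau S V ∈ ttBounded r S :=
  ⟨mask_mul_mat_tau V, fun b _ _ => rank_unfold_tau_le V b⟩

/-- At a tuple of cores of minimal size, the left interface matrices have left inverses and the
right ones have right inverses. -/
lemma exists_inverses {V : Cores r (HeadFeature M S)} (hV : tau S V ∈ ttManifold r S)
    {b : Fin (d + 1)} (h0 : b ≠ 0) (hl : b ≠ Fin.last d) :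
    (∃ H : Matrix (Fin (r b)) (Fin (r 0) × ({m : Fin d // m.val < b.val} → Feature p M)) ℝ,
        H * leftMat (extendCores V) b = 1) ∧
      ∃ G : Matrix ({m : Fin d // ¬ m.val < b.val} → Feature p M) (Fin (r b)) ℝ,
        rightMat (extendCores V) b * G = 1 := by
  have h := hV.2 b h0 hl
  rw [unfold_tau] at h
  exact ⟨exists_left_inverse_of_le_rank _ (h.symm.le.trans (Matrix.rank_mul_le_left _ _)),
    exists_right_inverse_of_le_rank _ (h.symm.le.trans (Matrix.rank_mul_le_right _ _))⟩

/-- Near cores of minimal size the tensor train map takes values in the manifold. -/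
lemma eventually_tau_mem_ttManifold {V : Cores r (HeadFeature M S)}
    (hV : tau S V ∈ ttManifold r S) : ∀ᶠ V' in 𝓝 V, tau S V' ∈ ttManifold r S := by
  have h : ∀ b : Fin (d + 1), ∀ᶠ V' in 𝓝 V,
      b ≠ 0 → b ≠ Fin.last d → r b ≤ (unfold (tau S V') b).rank := by
    intro b
    by_cases h0 : b = 0
    · exact Filter.Eventually.of_forall fun _ h => absurd h0 h
    by_cases hl : b = Fin.last d
    · exact Filter.Eventually.of_forall fun _ _ h => absurd hl h
    obtain ⟨⟨H, hH⟩, G, hG⟩ := exists_inverses hV h0 hl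
    have hcont : Continuous fun V' : Cores r (HeadFeature M S) => unfold (tau S V') b := by
      have := (contDiff_tau (M := M) (r := r) (S := S)).continuous
      refine continuous_matrix fun y z => ?_
      exact (EuclideanSpace.proj (𝕜 := ℝ) _).continuous.comp this
    have := hcont.tendsto V
    rw [unfold_tau V] at this
    filter_upwards [eventually_le_rank hH hG this] with V' hV' _ _ using hV'
  filter_upwards [Filter.eventually_all.2 h] with V' hV'
  exact ⟨mask_mul_mat_tau V', fun b h0 hl => le_antisymm (rank_unfold_tau_le V' b) (hV' b h0 hl)⟩

lemma hasDerivAt_tau_line (V Δ : Cores r (HeadFeature M S)) :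
    HasDerivAt (fun t : ℝ => tau S (V + t • Δ)) (fderiv ℝ (tau S) V Δ) 0 := by
  have h1 : HasDerivAt (fun t : ℝ => V + t • Δ) Δ 0 := by
    simpa using ((hasDerivAt_id (0 : ℝ)).smul_const Δ).const_add V
  have h2 : HasFDerivAt (tau S) (fderiv ℝ (tau S) V) (V + (0 : ℝ) • Δ) := by
    rw [zero_smul, add_zero]
    exact (contDiff_tau.differentiable (by simp) V).hasFDerivAt
  exact h2.comp_hasDerivAt (0 : ℝ) h1

lemma hasDerivAt_apply {F : Type} [Fintype F] {γ : ℝ → EuclideanSpace ℝ F}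
    {v : EuclideanSpace ℝ F} {t : ℝ} (h : HasDerivAt γ v t) (x : F) :
    HasDerivAt (fun s => γ s x) (v x) t :=
  (EuclideanSpace.proj (𝕜 := ℝ) x).hasFDerivAt.comp_hasDerivAt t h

/-- At cores of minimal size, the image of the derivative of the tensor train map is the tangent
space of the manifold of tensor trains. -/
lemma range_fderiv_tau (hd : 1 ≤ d) (hr : r (Fin.last d) = 1) {V : Cores r (HeadFeature M S)}
    (hV : tau S V ∈ ttManifold r S) :
    Set.range (fderiv ℝ (tau S) V) = tangentSpaceAt (ttManifold r S) (tau S V) := by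
  apply Set.Subset.antisymm
  · rintro _ ⟨Δ, rfl⟩
    have hline : ContDiff ℝ ∞ fun t : ℝ => V + t • Δ := by fun_prop
    refine ⟨fun t => tau S (V + t • Δ), contDiff_tau.comp hline, by simp, ?_,
      hasDerivAt_tau_line V Δ⟩
    have h0 : Filter.Tendsto (fun t : ℝ => V + t • Δ) (𝓝 0) (𝓝 V) := by
      simpa using hline.continuous.tendsto 0
    exact h0.eventually (eventually_tau_mem_ttManifold hV)
  · rintro v ⟨γ, -, hγ0, hγ, hv⟩
    obtain ⟨Δ, hΔ⟩ := exists_increment hd hr (extendCores V) v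
      (fun b h0 hl => (exists_inverses hV h0 hl).2) (by
        intro b h0 hl w hw
        obtain ⟨⟨H, hH⟩, G, hG⟩ := exists_inverses hV h0 hl
        have h := one_sub_mul_velocity_mulVec_eq_zero (A := fun t => unfold (γ t) b)
          (A' := unfold v b) hH hG (by rw [hγ0, unfold_tau])
          (hγ.mono fun t ht => (ht.2 b h0 hl).le) (fun _ _ => hasDerivAt_apply hv _) hw
        rw [Matrix.sub_mulVec, Matrix.one_mulVec, sub_eq_zero, ← Matrix.mulVec_mulVec] at h
        exact ⟨_, h⟩)
    refine ⟨restrictCores S Δ, ?_⟩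
    ext ⟨x, a⟩
    have h1 := hasDerivAt_apply (hasDerivAt_tau_line V (restrictCores S Δ)) (x, a)
    by_cases hx : ∀ m, Included S (x m)
    · simp only [tau_add_smul_restrictCores V Δ _ hx] at h1
      exact h1.unique (hΔ x a)
    · simp only [tau_apply_of_not_included _ hx] at h1
      refine (h1.unique (hasDerivAt_const _ _)).trans (Eq.symm ?_)
      refine (hasDerivAt_apply hv (x, a)).unique
        ((hasDerivAt_const (0 : ℝ) (0 : ℝ)).congr_of_eventuallyEq ?_)
      filter_upwards [hγ] with t ht
      exact (mask_mul_mat_eq_iff _).1 ht.1 x a hx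

end Head

/-! ### Updates of cores and super-cores, least squares -/

section BlockUpdates

variable {d : ℕ} {r : Fin (d + 1) → ℕ} {ι : Type}

lemma contract_replaceCore [Fintype ι] (V : Cores r ι) (i : Fin d)
    (z : EuclideanSpace ℝ (Fin (r i.castSucc) × ι × Fin (r i.succ))) (x : Fin d → ι)
    (a : Fin (r 0)) :
    contract (replaceCore V i z) (x, a) = ∑ α : (b : Fin (d + 1)) → Fin (r b),
      if α 0 = a then z (α i.castSucc, x i, α i.succ) *
        ∏ m ∈ Finset.univ.erase i, V m (α m.castSucc, x m, α m.succ) else 0 := by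
  refine Finset.sum_congr rfl fun α _ => ?_
  congr 1
  rw [← Finset.mul_prod_erase _ _ (Finset.mem_univ i)]
  congr 1
  · simp [replaceCore]
  · refine Finset.prod_congr rfl fun m hm => ?_
    simp [replaceCore, Function.update_of_ne (Finset.ne_of_mem_erase hm)]

lemma superContract_merge [Fintype ι] (V : Cores r ι) (k : Fin d) (h : k.val + 1 < d) :
    superContract V k h (merge V k h) = contract V := by
  ext ⟨x, a⟩
  let F : Fin (r k.succ) × ((b : {b : Fin (d + 1) // b ≠ k.succ}) → Fin (r b)) → ℝ := fun y =>
    if y.2 ⟨0, (Fin.succ_ne_zero k).symm⟩ = a then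
      V k (y.2 ⟨k.castSucc, (Fin.castSucc_lt_succ (i := k)).ne⟩, x k, y.1) *
        V (next k h) (y.1, x (next k h), y.2 ⟨(next k h).succ, by simp [Fin.ext_iff, next]⟩) *
        ∏ m : {m : Fin d // m ≠ k ∧ m ≠ next k h},
          V m (y.2 ⟨m.1.castSucc, fun e => m.2.2 (by simpa [Fin.ext_iff, next] using e)⟩, x m.1,
            y.2 ⟨m.1.succ, fun e => m.2.1 (by simpa using e)⟩)
    else 0
  trans ∑ y, F y
  · rw [Fintype.sum_prod_type, Finset.sum_comm]
    refine Finset.sum_congr rfl fun α _ => ?_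
    by_cases hα : α ⟨0, (Fin.succ_ne_zero k).symm⟩ = a
    · simp [F, hα, merge, Finset.sum_mul]
    · simp [F, hα]
  · rw [← (Equiv.piSplitAt k.succ fun b => Fin (r b)).sum_comp]
    refine Finset.sum_congr rfl fun α _ => ?_
    change (if α 0 = a then V k (α k.castSucc, x k, α k.succ) *
        V (next k h) (α (next k h).castSucc, x (next k h), α (next k h).succ) *
        ∏ m : {m : Fin d // m ≠ k ∧ m ≠ next k h},
          V m.1 (α m.1.castSucc, x m.1, α m.1.succ) else 0) = if α 0 = a then _ else 0
    congr 1
    have hne : next k h ≠ k := by simp [next, Fin.ext_iff]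
    rw [← Finset.mul_prod_erase _ _ (Finset.mem_univ k),
      ← Finset.mul_prod_erase _ _ (Finset.mem_erase.2 ⟨hne, Finset.mem_univ (next k h)⟩),
      Finset.prod_subtype (p := fun m => m ≠ k ∧ m ≠ next k h) _ (by simp [and_comm]), mul_assoc]

lemma superContract_congr {V V' : Cores r ι} (k : Fin d) (h : k.val + 1 < d)
    (hV : ∀ m, m ≠ k → m ≠ next k h → V' m = V m) :
    superContract V' k h = superContract V k h := by
  funext W
  ext ⟨x, a⟩
  refine Finset.sum_congr rfl fun α _ => ?_
  congr 2
  refine Finset.prod_congr rfl fun m _ => ?_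
  rw [hV m.1 m.2.1 m.2.2]

end BlockUpdates

section HeadUpdates

variable {p M d : ℕ} {r : Fin (d + 1) → ℕ} (S : Finset (Fin p))

/-- The embedding of the coefficient tensors of a head as a linear map. -/
def zeroExtendLin (l : ℕ) : Coeff (HeadFeature M S) d l →ₗ[ℝ] Coeff (Feature p M) d l where
  toFun := zeroExtend S
  map_add' B B' := by
    ext ⟨x, a⟩
    by_cases hx : ∀ m, Included S (x m) <;> simp [zeroExtend, hx]
  map_smul' c B := by
    ext ⟨x, a⟩
    by_cases hx : ∀ m, Included S (x m) <;> simp [zeroExtend, hx]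

/-- The coefficient tensor as a linear function of one core, the others being fixed. -/
def coreLin (V : Cores r (HeadFeature M S)) (i : Fin d) :
    EuclideanSpace ℝ (Fin (r i.castSucc) × HeadFeature M S × Fin (r i.succ)) →ₗ[ℝ]
      Coeff (Feature p M) d (r 0) :=
  zeroExtendLin S (r 0) ∘ₗ
    { toFun := fun z => contract (replaceCore V i z)
      map_add' := fun z z' => by
        ext ⟨x, a⟩
        rw [PiLp.add_apply]
        simp only [contract_replaceCore, ← Finset.sum_add_distrib]
        refine Finset.sum_congr rfl fun α _ => ?_
        split_ifs <;> simp [add_mul]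
      map_smul' := fun c z => by
        ext ⟨x, a⟩
        rw [PiLp.smul_apply]
        simp only [contract_replaceCore, Finset.smul_sum]
        refine Finset.sum_congr rfl fun α _ => ?_
        split_ifs <;> simp [mul_assoc] }

/-- The coefficient tensor as a linear function of a super-core, the other cores being fixed. -/
def superLin (V : Cores r (HeadFeature M S)) (k : Fin d) (h : k.val + 1 < d) :
    SuperCore r (HeadFeature M S) k h →ₗ[ℝ] Coeff (Feature p M) d (r 0) :=
  zeroExtendLin S (r 0) ∘ₗ
    { toFun := superContract V k h
      map_add' := fun W W' => by
        ext ⟨x, a⟩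
        rw [PiLp.add_apply]
        simp only [superContract, ← Finset.sum_add_distrib]
        refine Finset.sum_congr rfl fun α _ => ?_
        split_ifs <;> simp [add_mul]
      map_smul' := fun c W => by
        ext ⟨x, a⟩
        rw [PiLp.smul_apply]
        simp only [superContract, Finset.smul_sum]
        refine Finset.sum_congr rfl fun α _ => ?_
        split_ifs <;> simp [mul_assoc] }

lemma superLin_apply (V : Cores r (HeadFeature M S)) (k : Fin d) (h : k.val + 1 < d)
    (W : SuperCore r (HeadFeature M S) k h) : superLin S V k h W = superTau S V k h W := rfl

/-- If `V'` has the same cores as `V` away from `k` and `k + 1`, then its tensor results from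
`V` by a replacement of the super-core. -/
lemma superTau_merge {V V' : Cores r (HeadFeature M S)} (k : Fin d) (h : k.val + 1 < d)
    (hV : ∀ m, m ≠ k → m ≠ next k h → V' m = V m) :
    superTau S V k h (merge V' k h) = tau S V' := by
  rw [superTau, ← superContract_congr k h hV, superContract_merge, tau]

end HeadUpdates

section LeastSquares

variable {E F : Type} [AddCommGroup E] [Module ℝ E] [NormedAddCommGroup F]
  [InnerProductSpace ℝ F]

lemma exists_leastSquares [FiniteDimensional ℝ F] (A : E →ₗ[ℝ] F) (y : F) :
    ∃ z, ∀ z', ‖y - A z‖ ^ 2 ≤ ‖y - A z'‖ ^ 2 := by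
  obtain ⟨_, ⟨z, rfl⟩, hz⟩ := (LinearMap.range A).exists_norm_eq_iInf_of_complete_subspace
    (Submodule.complete_of_finiteDimensional _) y
  refine ⟨z, fun z' => ?_⟩
  gcongr
  rw [hz]
  exact ciInf_le ⟨0, by rintro _ ⟨w, rfl⟩; positivity⟩
    (⟨A z', LinearMap.mem_range_self A z'⟩ : LinearMap.range A)

/-- The theorem of Pythagoras for least squares: the residual of a minimizer is orthogonal to the
range of the map. -/
lemma norm_sq_sub_eq_of_leastSquares {A : E →ₗ[ℝ] F} {y : F} {z : E}
    (hz : ∀ z', ‖y - A z‖ ^ 2 ≤ ‖y - A z'‖ ^ 2) (z' : E) :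
    ‖y - A z'‖ ^ 2 = ‖y - A z‖ ^ 2 + ‖A (z - z')‖ ^ 2 := by
  have h : ‖y - A z‖ = ⨅ w : LinearMap.range A, ‖y - w‖ := by
    refine le_antisymm (le_ciInf ?_) (ciInf_le ⟨0, by rintro _ ⟨w, rfl⟩; positivity⟩
      (⟨A z, LinearMap.mem_range_self A z⟩ : LinearMap.range A))
    rintro ⟨_, w, rfl⟩
    exact (sq_le_sq₀ (norm_nonneg _) (norm_nonneg _)).1 (hz w)
  have h0 := ((LinearMap.range A).norm_eq_iInf_iff_real_inner_eq_zero
    (LinearMap.mem_range_self A z)).1 h (A (z - z')) (LinearMap.mem_range_self A _)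
  have e : y - A z' = (y - A z) + A (z - z') := by rw [map_sub]; abel
  rw [e, norm_add_sq_real, h0]
  ring

end LeastSquares

/-- A direction of negative slope is a direction of strict descent. -/
lemma eventually_lt_of_hasGradientAt {F : Type} [NormedAddCommGroup F] [InnerProductSpace ℝ F]
    [CompleteSpace F] {f : F → ℝ} {g x v : F} (hf : HasGradientAt f g x)
    (hv : inner ℝ g v < 0) : ∀ᶠ t in 𝓝[>] (0 : ℝ), f (x + t • v) < f x := by
  have h1 : HasDerivAt (fun t : ℝ => x + t • v) v 0 := by
    simpa using ((hasDerivAt_id (0 : ℝ)).smul_const v).const_add x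
  have h2 : HasFDerivAt f (InnerProductSpace.toDual ℝ F g) (x + (0 : ℝ) • v) := by
    rw [zero_smul, add_zero]
    exact hf.hasFDerivAt
  have h3 : HasDerivAt (fun t : ℝ => f (x + t • v)) (inner ℝ g v) 0 := by
    exact (h2.comp_hasDerivAt (0 : ℝ) h1).congr_deriv (by simp)
  have h4 := (hasDerivAt_iff_tendsto_slope.1 h3).mono_left
    (nhdsWithin_mono (0 : ℝ) fun t (ht : 0 < t) => ht.ne')
  filter_upwards [h4.eventually_lt_const hv, self_mem_nhdsWithin] with t ht ht0
  rw [slope_def_field, zero_smul, add_zero, sub_zero] at ht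
  have ht0' : 0 < t := ht0
  rw [div_neg_iff] at ht
  rcases ht with ht | ht <;> linarith [ht.1, ht.2]

/-! ### The parametrized loss and its gradient -/

section Loss

variable {p M d N l : ℕ}

/-- A matrix as a vector of the Euclidean space that carries the Frobenius inner product. -/
def flat {m n : Type} (A : Matrix m n ℝ) : EuclideanSpace ℝ (m × n) :=
  WithLp.toLp 2 fun x => A x.1 x.2

lemma frobSq_eq_norm_sq {m n : Type} [Fintype m] [Fintype n] (A : Matrix m n ℝ) :
    frobSq A = ‖flat A‖ ^ 2 := by
  rw [EuclideanSpace.real_norm_sq_eq, Fintype.sum_prod_type]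
  rfl

/-- The predictions of a head as a linear function of its coefficient tensor. -/
def prediction (N : ℕ) (u : ℤ → Fin p → ℝ) (S : Finset (Fin p)) :
    Coeff (Feature p M) d l →ₗ[ℝ] EuclideanSpace ℝ (Fin N × Fin l) where
  toFun B := flat (designIn M d N u S * mat B)
  map_add' B B' := by
    have : mat (B + B') = mat B + mat B' := rfl
    rw [this, Matrix.mul_add]
    rfl
  map_smul' c B := by
    have : mat (c • B) = c • mat B := rfl
    rw [this, Matrix.mul_smul]
    rfl

variable (u : ℤ → Fin p → ℝ) (S : Finset (Fin p))

lemma prediction_apply (B : Coeff (Feature p M) d l) :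
    prediction N u S B = flat (designIn M d N u S * mat B) := rfl

lemma loss_eq_norm_sq (Y : Matrix (Fin N) (Fin l) ℝ) (B : Coeff (Feature p M) d l) :
    loss u S Y B = ‖flat Y - prediction N u S B‖ ^ 2 :=
  frobSq_eq_norm_sq _

lemma inner_unmat_transpose_mul (R : Matrix (Fin N) (Fin l) ℝ) (B : Coeff (Feature p M) d l) :
    inner ℝ (unmat ((designIn M d N u S)ᵀ * R)) B = inner ℝ (flat R) (prediction N u S B) := by
  rw [PiLp.inner_apply, PiLp.inner_apply, Fintype.sum_prod_type, Fintype.sum_prod_type,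
    Finset.sum_comm]
  conv_rhs => rw [Finset.sum_comm]
  refine Finset.sum_congr rfl fun a _ => ?_
  simp only [prediction_apply, flat, unmat, Matrix.mul_apply, mat, Matrix.of_apply,
    Matrix.transpose_apply, RCLike.inner_apply, conj_trivial, Finset.mul_sum, Finset.sum_mul]
  rw [Finset.sum_comm]
  refine Finset.sum_congr rfl fun t _ => Finset.sum_congr rfl fun i _ => ?_
  ring

variable {r : Fin (d + 1) → ℕ}

lemma inner_gradPart (V Δ : Cores r (HeadFeature M S)) (R : Matrix (Fin N) (Fin (r 0)) ℝ) :
    inner ℝ (gradPart u S V R) Δ =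
      -2 * inner ℝ (unmat ((designIn M d N u S)ᵀ * R)) (fderiv ℝ (tau S) V Δ) := by
  rw [gradPart, inner_smul_left, ContinuousLinearMap.adjoint_inner_left]
  simp

lemma gradPart_add (V : Cores r (HeadFeature M S)) (R R' : Matrix (Fin N) (Fin (r 0)) ℝ) :
    gradPart u S V (R + R') = gradPart u S V R + gradPart u S V R' := by
  have : unmat ((designIn M d N u S)ᵀ * (R + R')) =
      unmat ((designIn M d N u S)ᵀ * R) + unmat ((designIn M d N u S)ᵀ * R') := by
    rw [Matrix.mul_add]
    rfl
  rw [gradPart, this, map_add, smul_add, gradPart, gradPart]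

lemma hasGradientAt_loss_tau (Y : Matrix (Fin N) (Fin (r 0)) ℝ) (V : Cores r (HeadFeature M S)) :
    HasGradientAt (fun V => loss u S Y (tau S V))
      (gradPart u S V (Y - designIn M d N u S * mat (tau S V))) V := by
  rw [hasGradientAt_iff_hasFDerivAt]
  have h1 : HasFDerivAt (tau S) (fderiv ℝ (tau S) V) V :=
    (contDiff_tau.differentiable (by simp) V).hasFDerivAt
  have h2 := (((prediction N u S).toContinuousLinearMap.hasFDerivAt.comp V h1).const_sub
    (flat Y)).norm_sq
  simp only [loss_eq_norm_sq]
  refine h2.congr_fderiv ?_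
  ext Δ
  rw [InnerProductSpace.toDual_apply_apply, inner_gradPart, inner_unmat_transpose_mul]
  have e : flat (Y - designIn M d N u S * mat (tau S V)) =
      flat Y - prediction N u S (tau S V) := rfl
  rw [e]
  simp only [inner_sub_left]
  simp
  ring

lemma mask_mul_mask : mask M d S * mask M d S = mask M d S := by
  simp [mask, Matrix.diagonal_mul_diagonal]

/-- The residual at `B₀` splits into the omitted dynamics, the projection error and the noise. -/
lemma residual_eq (Bstar B₀ : Coeff (Feature p M) d l) (E : Matrix (Fin N) (Fin l) ℝ) :
    designMatrix M d N u * mat Bstar + E - designIn M d N u S * mat B₀ =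
      resOmitted N u S Bstar + resProj N u S Bstar B₀ + E := by
  have h1 : (1 - mask M d S) * (1 - mask M d S) = 1 - mask M d S := by
    rw [Matrix.sub_mul, Matrix.one_mul, Matrix.mul_sub, Matrix.mul_one, mask_mul_mask, sub_self,
      sub_zero]
  have h2 : resOmitted N u S Bstar =
      designMatrix M d N u * mat Bstar - designIn M d N u S * mat Bstar := by
    rw [resOmitted, designOut, Matrix.mul_assoc, ← Matrix.mul_assoc (1 - mask M d S), h1,
      Matrix.sub_mul, Matrix.mul_sub, Matrix.one_mul, ← Matrix.mul_assoc, designIn]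
  have h3 : resProj N u S Bstar B₀ = designIn M d N u S * mat Bstar -
      designIn M d N u S * mat B₀ := by
    rw [resProj, Matrix.mul_sub, ← Matrix.mul_assoc, designIn,
      Matrix.mul_assoc (designMatrix M d N u), mask_mul_mask]
  rw [h2, h3]
  abel

end Loss

section Descent

variable {p M d N : ℕ} {r : Fin (d + 1) → ℕ} {u : ℤ → Fin p → ℝ} {S : Finset (Fin p)}
  {Y : Matrix (Fin N) (Fin (r 0)) ℝ} {V g : Cores r (HeadFeature M S)}

lemma replaceCore_self_sub {ι : Type} (V g : Cores r ι) (i : Fin d) (t : ℝ) :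
    replaceCore V i (V i - t • g i) = V + t • WithLp.toLp 2 (Pi.single i (-g i)) := by
  refine PiLp.ext fun k => ?_
  change Function.update V.ofLp i _ k = V k + t •
    (Pi.single i (-g i) : ∀ k, EuclideanSpace ℝ (Fin (r k.castSucc) × ι × Fin (r k.succ))) k
  rcases eq_or_ne k i with rfl | hk
  · rw [Function.update_self, Pi.single_eq_same, smul_neg, sub_eq_add_neg]
  · rw [Function.update_of_ne hk, Pi.single_eq_of_ne hk, smul_zero, add_zero]

/-- A nonzero block of the gradient allows for a decrease of the loss by the update of one
core. -/
lemma exists_replaceCore_lt (hg : HasGradientAt (fun V => loss u S Y (tau S V)) g V) {i : Fin d}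
    (hi : g i ≠ 0) : ∃ z, loss u S Y (tau S (replaceCore V i z)) < loss u S Y (tau S V) := by
  have hv : inner ℝ g (WithLp.toLp 2 (Pi.single i (-g i)) : Cores r (HeadFeature M S)) < 0 := by
    rw [PiLp.inner_apply, Finset.sum_eq_single i]
    · simpa using pow_pos (norm_pos_iff.2 hi) 2
    · intro k _ hk
      simp [hk]
    · simp
  obtain ⟨t, ht⟩ := (eventually_lt_of_hasGradientAt hg hv).exists
  exact ⟨V i - t • g i, by rwa [replaceCore_self_sub]⟩

lemma exists_coreLeastSquares (V : Cores r (HeadFeature M S)) (i : Fin d) :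
    ∃ z, ∀ z',
      loss u S Y (tau S (replaceCore V i z)) ≤ loss u S Y (tau S (replaceCore V i z')) := by
  simp only [loss_eq_norm_sq]
  exact exists_leastSquares (prediction N u S ∘ₗ coreLin S V i) (flat Y)

lemma exists_isSuperLS (V : Cores r (HeadFeature M S)) (k : Fin d) (h : k.val + 1 < d) :
    ∃ W, IsSuperLS u S Y V k h W := by
  simp only [IsSuperLS, loss_eq_norm_sq]
  exact exists_leastSquares (prediction N u S ∘ₗ superLin S V k h) (flat Y)

/-- A super-core contains all updates of its two cores, so its gain is at least theirs. -/
lemma lsGain_pos (hg : HasGradientAt (fun V => loss u S Y (tau S V)) g V) {i : Fin d}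
    (hi : g i ≠ 0) {k : Fin d} {h : k.val + 1 < d} (hik : i = k ∨ i = next k h)
    {W : SuperCore r (HeadFeature M S) k h} (hW : IsSuperLS u S Y V k h W) :
    0 < lsGain u S Y V k h W := by
  obtain ⟨z, hz⟩ := exists_replaceCore_lt hg hi
  have h1 := hW (merge (replaceCore V i z) k h)
  rw [superTau_merge S k h] at h1
  · rw [lsGain]
    linarith
  · intro m hm hm'
    have : m ≠ i := by rcases hik with rfl | rfl <;> assumption
    simp [replaceCore, Function.update_of_ne this]

/-- The truncation costs exactly the truncation loss, by the theorem of Pythagoras. -/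
lemma loss_sub_loss_eq {k : Fin d} {h : k.val + 1 < d}
    {W : SuperCore r (HeadFeature M S) k h} (hW : IsSuperLS u S Y V k h W)
    {V' : Cores r (HeadFeature M S)} (hV' : ∀ m, m ≠ k → m ≠ next k h → V' m = V m) :
    loss u S Y (tau S V) - loss u S Y (tau S V') =
      lsGain u S Y V k h W - truncationLoss N u S V k h W (merge V' k h) := by
  have h1 : ∀ W', ‖flat Y - (prediction N u S ∘ₗ superLin S V k h) W‖ ^ 2 ≤
      ‖flat Y - (prediction N u S ∘ₗ superLin S V k h) W'‖ ^ 2 := by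
    simp only [IsSuperLS, loss_eq_norm_sq] at hW
    exact hW
  have h2 := norm_sq_sub_eq_of_leastSquares h1 (merge V' k h)
  simp only [LinearMap.comp_apply, superLin_apply, superTau_merge S k h hV'] at h2
  rw [truncationLoss, lsGain, frobSq_eq_norm_sq, ← prediction_apply]
  simp only [loss_eq_norm_sq]
  linarith

end Descent

end THA


theorem theorem4 {p M d N : ℕ} (hd : 1 ≤ d)
    (r : Fin (d + 1) → ℕ) (hr : r (Fin.last d) = 1)
    (u : ℤ → Fin p → ℝ) (S : Finset (Fin p))
    (Bstar : Coeff (Feature p M) d (r 0)) (E Y : Matrix (Fin N) (Fin (r 0)) ℝ)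
    (hY : Y = designMatrix M d N u * mat Bstar + E)
    (B₀ : Coeff (Feature p M) d (r 0)) (hB₀ : IsFeasibleProjection r S Bstar B₀)
    (V₀ : Cores r (HeadFeature M S)) (hV₀ : tau S V₀ = B₀)
    (hreg : B₀ ∈ ttManifold r S)
    (T : Set (Coeff (Feature p M) d (r 0))) (hT : T = tangentSpaceAt (ttManifold r S) B₀)
    (C : Coeff (Feature p M) d (r 0)) (hC : C = globalCorrelation N u S Bstar)
    (j : Cores r (HeadFeature M S) → ℝ) (hj : j = fun V => loss u S Y (tau S V))
    (gOmitted gProj gNoise : Cores r (HeadFeature M S))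
    (hgOmitted : gOmitted = gradPart u S V₀ (resOmitted N u S Bstar))
    (hgProj : gProj = gradPart u S V₀ (resProj N u S Bstar B₀))
    (hgNoise : gNoise = gradPart u S V₀ E) :
    -- `τ` is smooth, and the image of its Jacobian at `V₀` is the tangent space
    (ContDiff ℝ ∞ (tau (M := M) (r := r) S) ∧
      Set.range (fderiv ℝ (tau (M := M) (r := r) S) V₀) = T) ∧
    -- the gradient of the parametrized loss and its three parts
    HasGradientAt j (gOmitted + gProj + gNoise) V₀ ∧
    -- the part due to the omitted dynamics is nonzero (equivalently, it has a nonzero block)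
    -- if and only if the global correlation is not orthogonal to the tangent space
    (gOmitted ≠ 0 ↔ ¬ OrthogonalTo C T) ∧
    ((∃ i : Fin d, gOmitted i ≠ 0) ↔ ¬ OrthogonalTo C T) ∧
    -- in that case it provides a tangent direction along which the fit to the omitted dynamics
    -- improves to first order
    (¬ OrthogonalTo C T →
      fderiv ℝ (tau S) V₀ (-gOmitted) ∈ T ∧ 0 < inner ℝ C (fderiv ℝ (tau S) V₀ (-gOmitted))) ∧
    -- and if it is not cancelled by the parts due to the projection error and the noise, then
    (¬ OrthogonalTo C T → gProj + gNoise ≠ -gOmitted →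
      -- `B₀` is not stationary, and the negative gradient is a descent direction away from `B₀`
      gOmitted + gProj + gNoise ≠ 0 ∧
      (∀ᶠ t in 𝓝[>] (0 : ℝ),
        j (V₀ - t • (gOmitted + gProj + gNoise)) < j V₀ ∧
        tau S (V₀ - t • (gOmitted + gProj + gNoise)) ∈ ttManifold r S ∧
        tau S (V₀ - t • (gOmitted + gProj + gNoise)) ≠ B₀) ∧
      -- some block of the gradient is nonzero, and for each such block
      (∃ i : Fin d, (gOmitted + gProj + gNoise) i ≠ 0) ∧
      ∀ i : Fin d, (gOmitted + gProj + gNoise) i ≠ 0 →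
        -- least-squares updates of this core exist, strictly decrease the loss and leave `B₀`
        (∃ z, ∀ z', j (replaceCore V₀ i z) ≤ j (replaceCore V₀ i z')) ∧
        (∀ z, (∀ z', j (replaceCore V₀ i z) ≤ j (replaceCore V₀ i z')) →
          j (replaceCore V₀ i z) < j V₀ ∧ tau S (replaceCore V₀ i z) ∈ ttBounded r S ∧
          tau S (replaceCore V₀ i z) ≠ B₀) ∧
        -- least-squares updates of each super-core that contains this core exist and have a
        -- positive gain, and the realized update after SVD truncation strictly decreases the
        -- loss and leaves `B₀` unless the truncation nullifies the gain
        ∀ (k : Fin d) (h : k.val + 1 < d), (i = k ∨ i = next k h) →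
          (∃ W, IsSuperLS u S Y V₀ k h W) ∧
          ∀ W, IsSuperLS u S Y V₀ k h W →
            0 < lsGain u S Y V₀ k h W ∧
            ∀ V₁, IsTruncatedUpdate V₀ V₁ k h W →
              j V₀ - j V₁ =
                lsGain u S Y V₀ k h W - truncationLoss N u S V₀ k h W (merge V₁ k h) ∧
              (truncationLoss N u S V₀ k h W (merge V₁ k h) < lsGain u S Y V₀ k h W →
                j V₁ < j V₀ ∧ tau S V₁ ∈ ttBounded r S ∧ tau S V₁ ≠ B₀)) := by
  have hB : tau S V₀ ∈ ttManifold r S := hV₀ ▸ hreg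
  have hrange : Set.range (fderiv ℝ (tau (M := M) (r := r) S) V₀) = T := by
    rw [hT, ← hV₀]
    exact range_fderiv_tau hd hr hB
  have hgrad : HasGradientAt j (gOmitted + gProj + gNoise) V₀ := by
    have := hasGradientAt_loss_tau u S Y V₀
    rwa [hV₀, hY, residual_eq, gradPart_add, gradPart_add, ← hgOmitted, ← hgProj, ← hgNoise,
      ← hY, ← hj] at this
  have hinner : ∀ Δ, inner ℝ gOmitted Δ = -2 * inner ℝ C (fderiv ℝ (tau S) V₀ Δ) := by
    intro Δ
    rw [hgOmitted, hC, inner_gradPart, globalCorrelation]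
  have hiff : gOmitted ≠ 0 ↔ ¬ OrthogonalTo C T := by
    rw [not_iff_not, ← hrange, OrthogonalTo, Set.forall_mem_range]
    constructor
    · intro h Δ
      have := hinner Δ
      rw [h, inner_zero_left] at this
      linarith
    · intro h
      rw [← inner_self_eq_zero (𝕜 := ℝ), hinner, h, mul_zero]
  have hblock : ∀ g : Cores r (HeadFeature M S), (∃ i : Fin d, g i ≠ 0) ↔ g ≠ 0 := by
    intro g
    rw [← not_iff_not, not_exists, not_not]
    constructor
    · intro h
      ext i y
      rw [not_not.1 (h i)]
      rfl
    · rintro rfl i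
      simp
  refine ⟨⟨contDiff_tau, hrange⟩, hgrad, hiff, (hblock _).trans hiff, fun hC' => ⟨?_, ?_⟩, ?_⟩
  · rw [← hrange]
    exact Set.mem_range_self _
  · have h1 := hinner gOmitted
    have h2 : 0 < inner ℝ gOmitted gOmitted := real_inner_self_pos.2 (hiff.2 hC')
    rw [map_neg, inner_neg_right]
    linarith
  · intro _ hcancel
    set g := gOmitted + gProj + gNoise with hgdef
    have hg : g ≠ 0 := by
      intro h
      apply hcancel
      rw [hgdef, add_assoc] at h
      exact eq_neg_of_add_eq_zero_right h
    -- tensors with different losses are different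
    have hne : ∀ V, j V < j V₀ → tau S V ≠ B₀ := by
      intro V hV h
      rw [hj] at hV
      simp only [h, hV₀, lt_irrefl] at hV
    refine ⟨hg, ?_, (hblock g).2 hg, fun i hi => ⟨?_, ?_, fun k h hik => ⟨?_, ?_⟩⟩⟩
    · have h1 : inner ℝ g (-g) < 0 := by
        rw [inner_neg_right, neg_lt_zero]
        exact real_inner_self_pos.2 hg
      have h2 : Filter.Tendsto (fun t : ℝ => V₀ - t • g) (𝓝[>] 0) (𝓝 V₀) := by
        have : Continuous fun t : ℝ => V₀ - t • g := by fun_prop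
        simpa using (this.tendsto 0).mono_left nhdsWithin_le_nhds
      filter_upwards [eventually_lt_of_hasGradientAt hgrad h1,
        h2.eventually (eventually_tau_mem_ttManifold hB)] with t ht1 ht2
      rw [smul_neg, ← sub_eq_add_neg] at ht1
      exact ⟨ht1, ht2, hne _ ht1⟩
    · rw [hj]
      exact exists_coreLeastSquares V₀ i
    · intro z hz
      have h1 : j (replaceCore V₀ i z) < j V₀ := by
        rw [hj] at hz hgrad ⊢
        obtain ⟨z', hz'⟩ := exists_replaceCore_lt hgrad hi
        exact (hz z').trans_lt hz'
      exact ⟨h1, tau_mem_ttBounded _, hne _ h1⟩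
    · exact exists_isSuperLS V₀ k h
    · intro W hW
      refine ⟨lsGain_pos (hj ▸ hgrad) hi hik hW, fun V₁ hV₁ => ?_⟩
      have h1 : j V₀ - j V₁ =
          lsGain u S Y V₀ k h W - truncationLoss N u S V₀ k h W (merge V₁ k h) := by
        rw [hj]
        exact loss_sub_loss_eq hW hV₁.2
      refine ⟨h1, fun hlt => ?_⟩
      have h2 : j V₁ < j V₀ := by linarith
      exact ⟨h2, tau_mem_ttBounded _, hne _ h2⟩
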